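/- Let $\kappa>1$ and $H(x,y)=\tfrac23(\kappa-1)x^3-(\kappa-1)x^2y+\tfrac{\kappa}{3}y^3-y$. The point $(1,1)$ is a center of the Hamiltonian system $\dot x=H_y$, $\dot y=-H_x$, with $H(1,1)=-\tfrac23$, and its period annulus is filled by ovals $\Gamma_h\subset\{H=h\}$, $h\in\left(-\tfrac23,-\tfrac{2}{3\sqrt\kappa}\right)$. For such $h$ let $D_h$ be the region bounded by $\Gamma_h$, i.e. the connected component of $\{(x,y)\in\mathbb R^2: H(x,y)<h\}$ containing $(1,1)$, and for integers $i,j$ put $$I_{i,j}(h)=\iint_{D_h}x^iy^j\,dx\,dy .$$ For real parameters $\mu_1,\mu_2,\mu_3,\mu_4$ let $$I(h)=\mu_1hI_{0,0}(h)+\mu_2I_{1,0}(h)+\mu_3I_{0,1}(h)+\mu_4\bigl(2I_{-1,0}(h)+3\kappa hI_{-1,1}(h)\bigr),$$ and for $s\in(1,\kappa)$ write $I(s)=I(h(s))$ with $h(s)=-\tfrac23\sqrt{s/\kappa}\in\left(-\tfrac23,-\tfrac{2}{3\sqrt\kappa}\right)$. Then: (i) $I(s)=0$ for all $s\in(1,\kappa)$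 if and only if $\mu_1=\mu_2=\mu_3=\mu_4=0$. (ii) For every $\delta>0$ there exist $\mu_1,\mu_2,\mu_3,\mu_4\in\mathbb R$ such that $I(s)$ does not vanish identically on $(1,\kappa)$ and has at least three distinct zeros in $(1,\kappa)\cap(\kappa-\delta,\kappa)$. In particular, the parameters can be chosen so that $I(s)$ has at least three zeros in $(1,\kappa)$, arbitrarily close to the value $s=\kappa$ that corresponds to the center. -/

import Mathlib

namespace QuadraticFour

/-- The Hamiltonian `H(x,y) = (2/3)(κ-1)x³ - (κ-1)x²y + (κ/3)y³ - y`. -/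
noncomputable def H (κ : ℝ) (p : ℝ × ℝ) : ℝ :=
  2 / 3 * (κ - 1) * p.1 ^ 3 - (κ - 1) * p.1 ^ 2 * p.2 + κ / 3 * p.2 ^ 3 - p.2

/-- The region bounded by the oval `H = h` around the center `(1,1)`: the connected component
containing `(1,1)` of the sublevel set `{H < h}` (the whole sublevel set is unbounded). -/
def region (κ h : ℝ) : Set (ℝ × ℝ) :=
  connectedComponentIn {p : ℝ × ℝ | H κ p < h} (1, 1)

/-- `I_{i,j}(h) = ∬ xⁱ yʲ dx dy` over the region bounded by the oval `H = h`; the exponents are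
integers, since `i = -1` is needed. -/
noncomputable def Iij (κ : ℝ) (i j : ℤ) (h : ℝ) : ℝ :=
  ∫ p in region κ h, p.1 ^ i * p.2 ^ j

/-- The generating function in the variable `h`. -/
noncomputable def genH (κ μ₁ μ₂ μ₃ μ₄ h : ℝ) : ℝ :=
  μ₁ * h * Iij κ 0 0 h + μ₂ * Iij κ 1 0 h + μ₃ * Iij κ 0 1 h
    + μ₄ * (2 * Iij κ (-1) 0 h + 3 * κ * h * Iij κ (-1) 1 h)

/-- The change of variable `h(s) = -(2/3)√(s/κ)`, which maps `(1,κ)` decreasingly onto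
`(-2/3, -2/(3√κ))`. -/
noncomputable def hOf (κ s : ℝ) : ℝ := -(2 / 3) * Real.sqrt (s / κ)

/-- The generating function in the variable `s`. -/
noncomputable def genS (κ μ₁ μ₂ μ₃ μ₄ s : ℝ) : ℝ :=
  genH κ μ₁ μ₂ μ₃ μ₄ (hOf κ s)

end QuadraticFour

namespace QuadraticFour
open Real Set MeasureTheory Filter Topology Asymptotics

/-! Both parts reduce to one fact: no nontrivial combination of the four generating functions
vanishes on `(1,κ)`. Given this, any three points of the interval can be made zeros: the three
conditions are linear in four parameters, so a nonzero solution exists, and by independence its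
function is not identically zero. The points may be taken as near `κ` as desired.

Independence is read off from the expansion at the center. With `d = s/κ = 9h²/4` and `x = u y`, the
oval becomes a depressed cubic in `y` over each ratio `u`; the trigonometric formula for its roots
gives explicit fibres and moments. The admissible ratios satisfy `profile κ u * d < 1`. The
substitutions `u = 1/2 + cos (π/3 - τ)`, `sin (3τ/2) = r sin φ` turn this into `|φ| < π/2`, a range
that does not move with `d` (`image_ratioOf`). After averaging over `φ ↦ -φ`, the integrand depends
only on `(1-d) cos² φ` and `(r sin φ)²`, through the `kernel`, whose four coefficients `b₀,…,b₃` are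
an invertible linear image of the `μᵢ` (`genH_eq_kernel`).

Put `δ = 1 - d` and `t = 1/(κ-1)`, so `r² = t δ/(1-δ)`. The kernel expands to third order in `δ`,
uniformly in `φ`, with polynomial coefficients in `sin² φ` (`hasExpansion_kernel`). If the integral
vanishes for all small `δ`, the four integrated coefficients vanish. This is a 4×4 linear system for
the `bᵢ` with only the trivial solution for `t > 0` (`coeffs_eq_zero`). -/

/-- In the coordinates `x = u y` the Hamiltonian is `H = profile κ u / 3 * y³ - y`. -/
noncomputable def profile (κ u : ℝ) : ℝ := κ - (κ - 1) * u ^ 2 * (3 - 2 * u)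

theorem H_mul (κ u y : ℝ) : H κ (u * y, y) = profile κ u / 3 * y ^ 3 - y := by
  simp only [H, profile]; ring

theorem one_le_profile {κ u : ℝ} (hκ : 1 < κ) (hu : 0 < u) : 1 ≤ profile κ u := by
  have : profile κ u - 1 = (κ - 1) * ((u - 1) ^ 2 * (2 * u + 1)) := by simp only [profile]; ring
  have : 0 ≤ (κ - 1) * ((u - 1) ^ 2 * (2 * u + 1)) := by
    have : 0 ≤ κ - 1 := by linarith
    positivity
  linarith

/-! ### Trigonometric solution of the fibre cubic -/

/-- One third of the angle whose cosine is `c`. -/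
noncomputable def third (c : ℝ) : ℝ := arccos c / 3

theorem cos_three_third {c : ℝ} (h0 : 0 ≤ c) (h1 : c ≤ 1) :
    4 * cos (third c) ^ 3 - 3 * cos (third c) = c := by
  rw [← cos_three_mul, third, mul_div_cancel₀ _ (by norm_num : (3 : ℝ) ≠ 0),
    cos_arccos (by linarith) h1]

theorem third_nonneg (c : ℝ) : 0 ≤ third c := by
  have := arccos_nonneg c
  unfold third; positivity

theorem third_lt {c : ℝ} (h0 : 0 < c) : third c < π / 6 := by
  have := arccos_lt_pi_div_two.2 h0
  unfold third; linarith

/-- Together with `sin_third_lt` this gives `√3 sin θ < cos θ`, so both endpoints of a fibre are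
positive. -/
theorem cos_third_gt {c : ℝ} (h0 : 0 < c) : √3 / 2 < cos (third c) := by
  rw [← cos_pi_div_six]
  exact cos_lt_cos_of_nonneg_of_le_pi (third_nonneg c) (by linarith [pi_pos]) (third_lt h0)

theorem sin_third_lt {c : ℝ} (h0 : 0 < c) : sin (third c) < 1 / 2 := by
  rw [← sin_pi_div_six]
  exact sin_lt_sin_of_lt_of_le_pi_div_two (by linarith [pi_pos, third_nonneg c])
    (by linarith [pi_pos]) (third_lt h0)

theorem sin_third_nonneg {c : ℝ} (h0 : 0 < c) : 0 ≤ sin (third c) :=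
  sin_nonneg_of_nonneg_of_le_pi (third_nonneg c) (by linarith [pi_pos, third_lt h0])

/-- The sublevel sets of the depressed cubic `z³ - 3z`. -/
theorem cubic_lt_iff {c z : ℝ} (h0 : 0 < c) (hz : 0 < z) (h1 : c < 1) :
    z ^ 3 - 3 * z < -2 * c ↔ |z - cos (third c)| < √3 * sin (third c) := by
  have hc := cos_three_third h0.le h1.le
  have hC : 0 < cos (third c) := lt_trans (by positivity) (cos_third_gt h0)
  have hS := sin_third_nonneg h0
  have h3 : √3 ^ 2 = 3 := by norm_num
  have hsc := sin_sq_add_cos_sq (third c)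
  set C := cos (third c)
  set S := sin (third c)
  -- The roots of the cubic are `-2 cos θ` and `cos θ ± √3 sin θ` with `cos 3θ = c`; only the last
  -- two matter for `z > 0`.
  have key : z ^ 3 - 3 * z + 2 * c = (z + 2 * C) * ((z - C) ^ 2 - (√3 * S) ^ 2) := by
    rw [← hc, mul_pow, h3, show S ^ 2 = 1 - C ^ 2 by linarith]; ring
  have hpos : 0 < z + 2 * C := by positivity
  rw [← abs_of_nonneg (by positivity : 0 ≤ √3 * S), ← sq_lt_sq]
  constructor
  · intro h
    by_contra h'
    push Not at h'
    have := mul_nonneg hpos.le (sub_nonneg.2 h')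
    linarith
  · intro h
    have := mul_neg_of_pos_of_neg hpos (sub_neg.2 h)
    linarith

/-- The fibres of the sublevel set over a fixed ratio `u = x / y`, written with `p = profile κ u`
and `d = 9h²/4`. -/
theorem fibre_lt_iff {p d y : ℝ} (hp : 0 < p) (hd : 0 < d) (hy : 0 < y) :
    p / 3 * y ^ 3 - y < -(2 / 3) * √d ↔
      p * d < 1 ∧ |√p * y - cos (third √(p * d))| < √3 * sin (third √(p * d)) := by
  have hsp : 0 < √p := sqrt_pos.2 hp
  have hc0 : 0 < √(p * d) := sqrt_pos.2 (by positivity)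
  have hz : 0 < √p * y := by positivity
  have hiff : p / 3 * y ^ 3 - y < -(2 / 3) * √d ↔
      (√p * y) ^ 3 - 3 * (√p * y) < -2 * √(p * d) := by
    rw [sqrt_mul hp.le]
    have e1 : (√p * y) ^ 3 - 3 * (√p * y) + 2 * (√p * √d)
        = 3 * √p * (p / 3 * y ^ 3 - y + 2 / 3 * √d) := by
      have : √p ^ 2 = p := sq_sqrt hp.le
      rw [show (√p * y) ^ 3 = √p ^ 2 * √p * y ^ 3 by ring, this]; ring
    have hpos : 0 < 3 * √p := by positivity
    constructor
    · intro h
      have := mul_neg_of_pos_of_neg hpos (show p / 3 * y ^ 3 - y + 2 / 3 * √d < 0 by linarith)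
      linarith
    · intro h
      by_contra h'
      have := mul_nonneg hpos.le (show 0 ≤ p / 3 * y ^ 3 - y + 2 / 3 * √d by linarith)
      linarith
  rw [hiff]
  have hlt : √(p * d) < 1 ↔ p * d < 1 := by rw [sqrt_lt' one_pos, one_pow]
  constructor
  · intro h
    have h1 : √(p * d) < 1 := by
      by_contra h'
      -- For `z > 0`, `z³ - 3z + 2 = (z-1)²(z+2) ≥ 0`, so the fibre is empty once `c ≥ 1`.
      have : 0 ≤ (√p * y - 1) ^ 2 * (√p * y + 2) := by positivity
      nlinarith
    exact ⟨hlt.1 h1, (cubic_lt_iff hc0 hz h1).1 h⟩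
  · rintro ⟨h1, h2⟩
    exact (cubic_lt_iff hc0 hz (hlt.2 h1)).2 h2

/-! ### The interval of ratios and its angular parametrization -/

/-- The part of the sublevel set in the open first quadrant. -/
def quadrantRegion (κ h : ℝ) : Set (ℝ × ℝ) := {p | 0 < p.1 ∧ 0 < p.2 ∧ H κ p < h}

/-- The ratios `u = x / y` met by the region with `h = -(2/3)√d`. -/
def ratios (κ d : ℝ) : Set ℝ := {u | 0 < u ∧ profile κ u * d < 1}

theorem ratios_lt {κ d u : ℝ} (hκ : 1 < κ) (hd0 : 0 < d) (hd : 1 < κ * d) (hu : u ∈ ratios κ d) :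
    u < 3 / 2 := by
  by_contra h
  have h2 := hu.2
  have : profile κ u = κ + (κ - 1) * (u ^ 2 * (2 * u - 3)) := by unfold profile; ring
  have h3 : 0 ≤ (κ - 1) * (u ^ 2 * (2 * u - 3)) :=
    mul_nonneg (by linarith) (mul_nonneg (sq_nonneg u) (by linarith))
  nlinarith [mul_nonneg h3 hd0.le]

/-- The arc parameter `τ` on which `u = 1/2 + cos (π/3 - τ)`. -/
noncomputable def arc (r φ : ℝ) : ℝ := 2 / 3 * arcsin (r * sin φ)

noncomputable def ratioOf (r φ : ℝ) : ℝ := 1 / 2 + cos (π / 3 - arc r φ)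

/-- With `u = 1/2 + c` the quadratic term of `u² (3 - 2u)` cancels, leaving `(1 - (4c³ - 3c))/2`: a
triple angle. -/
theorem profile_cos (κ τ : ℝ) :
    profile κ (1 / 2 + cos (π / 3 - τ)) = 1 + (κ - 1) * sin (3 * τ / 2) ^ 2 := by
  have h1 : cos (3 * (π / 3 - τ)) = -cos (2 * (3 * τ / 2)) := by
    rw [show 3 * (π / 3 - τ) = π - 2 * (3 * τ / 2) by ring, cos_pi_sub]
  rw [cos_three_mul, cos_two_mul, cos_sq'] at h1
  unfold profile
  linear_combination (κ - 1) / 2 * h1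

theorem abs_mul_sin_lt {r : ℝ} (hr0 : 0 ≤ r) (hr : r < 1) (φ : ℝ) : |r * sin φ| < 1 := by
  rw [abs_mul, abs_of_nonneg hr0]
  nlinarith [abs_sin_le_one φ, abs_nonneg (sin φ)]

theorem sin_arc {r : ℝ} (hr0 : 0 ≤ r) (hr : r < 1) (φ : ℝ) :
    sin (3 * arc r φ / 2) = r * sin φ := by
  have := abs_lt.1 (abs_mul_sin_lt hr0 hr φ)
  rw [arc, show 3 * (2 / 3 * arcsin (r * sin φ)) / 2 = arcsin (r * sin φ) by ring,
    sin_arcsin this.1.le this.2.le]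

theorem arc_mem {r : ℝ} (hr0 : 0 ≤ r) (hr : r < 1) (φ : ℝ) :
    arc r φ ∈ Ioo (-(π / 3)) (π / 3) := by
  have := abs_lt.1 (abs_mul_sin_lt hr0 hr φ)
  have h1 := neg_pi_div_two_lt_arcsin.2 this.1
  have h2 := arcsin_lt_pi_div_two.2 this.2
  constructor <;> unfold arc <;> linarith

theorem ratioOf_pos {r : ℝ} (hr0 : 0 ≤ r) (hr : r < 1) (φ : ℝ) : 0 < ratioOf r φ := by
  have h := arc_mem hr0 hr φ
  have : cos (2 * π / 3) < cos (π / 3 - arc r φ) :=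
    cos_lt_cos_of_nonneg_of_le_pi (by linarith [h.2]) (by linarith [pi_pos]) (by linarith [h.1])
  rw [show 2 * π / 3 = π - π / 3 by ring, cos_pi_sub, cos_pi_div_three] at this
  unfold ratioOf; linarith

theorem profile_ratioOf (κ : ℝ) {r : ℝ} (hr0 : 0 ≤ r) (hr : r < 1) (φ : ℝ) :
    profile κ (ratioOf r φ) = 1 + (κ - 1) * (r * sin φ) ^ 2 := by
  rw [ratioOf, profile_cos, sin_arc hr0 hr]

theorem injOn_ratioOf {r : ℝ} (hr0 : 0 < r) (hr : r < 1) :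
    InjOn (ratioOf r) (Ioo (-(π / 2)) (π / 2)) := by
  intro a ha b hb hab
  have h1 := arc_mem hr0.le hr a
  have h2 := arc_mem hr0.le hr b
  have h3 : π / 3 - arc r a = π / 3 - arc r b :=
    injOn_cos ⟨by linarith [h1.2], by linarith [h1.1, pi_pos]⟩
      ⟨by linarith [h2.2], by linarith [h2.1, pi_pos]⟩ (by unfold ratioOf at hab; linarith)
  have h4 : sin a = sin b := by
    have e1 := sin_arc hr0.le hr a
    rw [show arc r a = arc r b by linarith, sin_arc hr0.le hr b] at e1
    exact (mul_left_cancel₀ hr0.ne' e1).symm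
  exact injOn_sin ⟨ha.1.le, ha.2.le⟩ ⟨hb.1.le, hb.2.le⟩ h4

theorem image_ratioOf {κ d r : ℝ} (hκ : 1 < κ) (hd0 : 0 < d) (hd : 1 < κ * d) (hr0 : 0 < r)
    (hr : (κ - 1) * r ^ 2 * d = 1 - d) :
    ratioOf r '' Ioo (-(π / 2)) (π / 2) = ratios κ d := by
  -- If `r ≥ 1`, the relation for `r` would give `(κ-1) d ≤ 1 - d`, that is `κ d ≤ 1`.
  have hr1 : r < 1 := by
    by_contra h
    have : 1 ≤ r ^ 2 := by nlinarith
    nlinarith [mul_le_mul_of_nonneg_left this (mul_nonneg (sub_nonneg.2 hκ.le) hd0.le)]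
  ext u
  constructor
  · rintro ⟨φ, hφ, rfl⟩
    refine ⟨ratioOf_pos hr0.le hr1 φ, ?_⟩
    rw [profile_ratioOf κ hr0.le hr1]
    have hc : 0 < cos φ := cos_pos_of_mem_Ioo hφ
    have h1 : (1 + (κ - 1) * (r * sin φ) ^ 2) * d = d + (1 - d) * sin φ ^ 2 := by
      rw [← hr]; ring
    rw [h1, sin_sq]
    have hlt : 0 < (1 - d) := by
      rw [← hr]; have : 0 < κ - 1 := by linarith
      positivity
    nlinarith [mul_pos hlt (pow_pos hc 2)]
  · intro hu
    have hu1 := ratios_lt hκ hd0 hd hu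
    have hu0 := hu.1
    set τ := π / 3 - arccos (u - 1 / 2) with hτ
    have hcos : 1 / 2 + cos (π / 3 - τ) = u := by
      rw [hτ, sub_sub_cancel, cos_arccos (by linarith) (by linarith)]; ring
    have hp : profile κ u = 1 + (κ - 1) * sin (3 * τ / 2) ^ 2 := by rw [← profile_cos, hcos]
    have hτ2 : τ ≤ π / 3 := by have := arccos_nonneg (u - 1 / 2); linarith
    have hτ1 : -(π / 3) ≤ τ := by
      have : arccos (u - 1 / 2) ≤ arccos (-(1 / 2)) := arccos_le_arccos (by linarith)
      have e : arccos (-(1 / 2)) = π - π / 3 := by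
        rw [arccos_neg, ← cos_pi_div_three, arccos_cos (by positivity) (by linarith [pi_pos])]
      linarith
    -- Since `(κ-1) r² d = 1 - d`, this is exactly the condition `profile κ u * d < 1`.
    have hw : |sin (3 * τ / 2)| < r := by
      rw [← abs_of_pos hr0, ← sq_lt_sq]
      have h2 := hu.2
      rw [hp] at h2
      have : 0 < (κ - 1) * d := mul_pos (by linarith) hd0
      by_contra h
      nlinarith [mul_nonneg this.le (sub_nonneg.2 (not_lt.1 h))]
    have hw' : |sin (3 * τ / 2) / r| < 1 := by
      rw [abs_div, abs_of_pos hr0, div_lt_one hr0]; exact hw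
    rw [abs_lt] at hw'
    refine ⟨arcsin (sin (3 * τ / 2) / r), ⟨?_, ?_⟩, ?_⟩
    · exact neg_pi_div_two_lt_arcsin.2 hw'.1
    · exact arcsin_lt_pi_div_two.2 hw'.2
    · rw [ratioOf, arc, sin_arcsin hw'.1.le hw'.2.le, mul_div_cancel₀ _ hr0.ne',
        arcsin_sin (by linarith) (by linarith), show 2 / 3 * (3 * τ / 2) = τ by ring, hcos]

/-! ### The bounded component is the first-quadrant part of the sublevel set -/

theorem mem_quadrantRegion_iff {κ d u y : ℝ} (hκ : 1 < κ) (hd : 0 < d) (hu : 0 < u) (hy : 0 < y) :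
    (u * y, y) ∈ quadrantRegion κ (-(2 / 3) * √d) ↔ u ∈ ratios κ d ∧
      |√(profile κ u) * y - cos (third √(profile κ u * d))|
        < √3 * sin (third √(profile κ u * d)) := by
  have hp := one_le_profile hκ hu
  simp only [quadrantRegion, ratios, mem_ofPred_eq, H_mul,
    fibre_lt_iff (by linarith : 0 < profile κ u) hd hy]
  have : 0 < u * y := by positivity
  tauto

theorem isPreconnected_quadrantRegion {κ d : ℝ} (hκ : 1 < κ) (hd0 : 0 < d) (hd1 : d < 1)
    (hd : 1 < κ * d) : IsPreconnected (quadrantRegion κ (-(2 / 3) * √d)) := by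
  set r := √((1 - d) / ((κ - 1) * d)) with hr
  have hq : 0 < κ - 1 := by linarith
  have hr0 : 0 < r := sqrt_pos.2 (div_pos (by linarith) (by positivity))
  have hrr : (κ - 1) * r ^ 2 * d = 1 - d := by
    rw [hr, sq_sqrt (div_nonneg (by linarith) (by positivity))]; field_simp
  have himg := image_ratioOf hκ hd0 hd hr0 hrr
  -- The region is the continuous image of a rectangle: `φ` selects the ratio, the second variable
  -- in `(-1,1)` the relative position in the fibre.
  let f : ℝ × ℝ → ℝ × ℝ := fun z =>
    let u := ratioOf r z.1
    let y := (cos (third √(profile κ u * d)) + z.2 * (√3 * sin (third √(profile κ u * d))))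
      / √(profile κ u)
    (u * y, y)
  have hconn : IsPreconnected (Ioo (-(π / 2)) (π / 2) ×ˢ Ioo (-1 : ℝ) 1) :=
    isPreconnected_Ioo.prod isPreconnected_Ioo
  have hprof : ∀ φ ∈ Ioo (-(π / 2)) (π / 2), ratioOf r φ ∈ ratios κ d := fun φ hφ =>
    himg ▸ mem_image_of_mem _ hφ
  have hcu : Continuous (ratioOf r) := by unfold ratioOf arc; fun_prop
  have hcp : Continuous (profile κ) := by unfold profile; fun_prop
  have hct : Continuous third := by unfold third; fun_prop
  have hcont : ContinuousOn f (Ioo (-(π / 2)) (π / 2) ×ˢ Ioo (-1 : ℝ) 1) := by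
    have hcy : ContinuousOn (fun z : ℝ × ℝ =>
        (cos (third √(profile κ (ratioOf r z.1) * d))
          + z.2 * (√3 * sin (third √(profile κ (ratioOf r z.1) * d))))
        / √(profile κ (ratioOf r z.1))) (Ioo (-(π / 2)) (π / 2) ×ˢ Ioo (-1 : ℝ) 1) := by
      refine ContinuousOn.div (Continuous.continuousOn ?_) (Continuous.continuousOn ?_) ?_
      · fun_prop
      · fun_prop
      · rintro ⟨φ, w⟩ ⟨hφ, -⟩
        have := one_le_profile hκ (hprof φ hφ).1
        exact (sqrt_pos.2 (by linarith)).ne'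
    exact ((hcu.comp continuous_fst).continuousOn.mul hcy).prodMk hcy
  convert hconn.image f hcont using 1
  ext ⟨x, y⟩
  constructor
  · rintro h
    have hx0 : 0 < x := h.1
    have hy0 : 0 < y := h.2.1
    have hu0 : 0 < x / y := by positivity
    have hxy : x / y * y = x := by field_simp
    have h' : (x / y * y, y) ∈ quadrantRegion κ (-(2 / 3) * √d) := by rwa [hxy]
    obtain ⟨hu, hy⟩ := (mem_quadrantRegion_iff hκ hd0 hu0 hy0).1 h'
    obtain ⟨φ, hφ, hφu⟩ := himg.symm ▸ hu
    have hp := one_le_profile hκ hu0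
    have hsp : 0 < √(profile κ (x / y)) := sqrt_pos.2 (by linarith)
    set C := cos (third √(profile κ (x / y) * d)) with hC
    set S := √3 * sin (third √(profile κ (x / y) * d)) with hS
    have hSp : 0 < S := lt_of_le_of_lt (abs_nonneg _) hy
    refine ⟨(φ, (√(profile κ (x / y)) * y - C) / S), ⟨hφ, ?_⟩, ?_⟩
    · rw [mem_Ioo, ← abs_lt, abs_div, abs_of_pos hSp, div_lt_one hSp]; exact hy
    · have : (cos (third √(profile κ (x / y) * d)) + (√(profile κ (x / y)) * y - C) / S
          * (√3 * sin (third √(profile κ (x / y) * d)))) / √(profile κ (x / y)) = y := by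
        rw [← hC, ← hS]; field_simp; ring
      simp only [f, hφu]
      rw [this, hxy]
  · rintro ⟨⟨φ, w⟩, ⟨hφ, hw⟩, hfw⟩
    have hu := hprof φ hφ
    have hp := one_le_profile hκ hu.1
    have hsp : 0 < √(profile κ (ratioOf r φ)) := sqrt_pos.2 (by linarith)
    have hc0 : 0 < √(profile κ (ratioOf r φ) * d) := sqrt_pos.2 (by nlinarith)
    have hc1 : √(profile κ (ratioOf r φ) * d) < 1 := by
      rw [sqrt_lt' one_pos, one_pow]; exact hu.2
    have hCS : √3 * sin (third √(profile κ (ratioOf r φ) * d))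
        < cos (third √(profile κ (ratioOf r φ) * d)) := by
      have := cos_third_gt hc0
      have := sin_third_lt hc0
      have : 0 < √3 := by positivity
      nlinarith
    have hS : 0 < √3 * sin (third √(profile κ (ratioOf r φ) * d)) := by
      refine mul_pos (by positivity) (sin_pos_of_pos_of_lt_pi ?_ ?_)
      · have := arccos_pos.2 hc1
        unfold third; positivity
      · linarith [third_lt hc0, pi_pos]
    simp only [f] at hfw
    set C := cos (third √(profile κ (ratioOf r φ) * d)) with hC
    set S := √3 * sin (third √(profile κ (ratioOf r φ) * d)) with hSd
    rw [mem_Ioo] at hw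
    have hnum : 0 < C + w * S := by nlinarith [hw.1]
    rw [← hfw, mem_quadrantRegion_iff hκ hd0 hu.1 (div_pos hnum hsp)]
    refine ⟨hu, ?_⟩
    rw [mul_div_cancel₀ _ hsp.ne', ← hC, ← hSd, add_sub_cancel_left, abs_mul, abs_of_pos hS]
    have := abs_lt.2 hw
    nlinarith

/-- The period annulus lies in the open first quadrant, and there the sublevel set is connected. -/
theorem region_eq {κ d : ℝ} (hκ : 1 < κ) (hd0 : 0 < d) (hd1 : d < 1) (hd : 1 < κ * d) :
    region κ (-(2 / 3) * √d) = quadrantRegion κ (-(2 / 3) * √d) := by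
  have h11 : H κ (1, 1) < -(2 / 3) * √d := by
    have : √d < 1 := by rwa [sqrt_lt' one_pos, one_pow]
    simp only [H]; linarith
  have hsκ : 1 < √κ * √d := by
    rw [← sqrt_mul (by linarith), lt_sqrt zero_le_one]; simpa using hd
  apply Subset.antisymm
  · have hU : IsOpen {p : ℝ × ℝ | 0 < p.1 ∧ 0 < p.2} :=
      (isOpen_lt continuous_const continuous_fst).inter (isOpen_lt continuous_const continuous_snd)
    have hV : IsOpen {p : ℝ × ℝ | p.1 < 0 ∨ p.2 < 0} :=
      (isOpen_lt continuous_fst continuous_const).union (isOpen_lt continuous_snd continuous_const)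
    have hsub := connectedComponentIn_subset {p : ℝ × ℝ | H κ p < -(2 / 3) * √d} (1, 1)
    -- The component cannot leave the open quadrant, because `H ≥ h` on the two closed half-axes
    -- bounding it.
    have := IsPreconnected.subset_left_of_subset_union hU hV (by
        rw [Set.disjoint_left]
        rintro p ⟨h1, h2⟩ (h3 | h3) <;> linarith) (s := region κ (-(2 / 3) * √d)) (by
        intro p hp
        have hp := hsub hp
        by_contra hn
        simp only [mem_union, mem_ofPred_eq, not_or, not_and, not_lt] at hn hp
        obtain ⟨h1, h2, h3⟩ := hn
        obtain ⟨x, y⟩ := p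
        simp only [H] at h1 h2 h3 hp
        rcases h2.eq_or_lt with h | h
        · subst h
          have hk : √κ ^ 2 = κ := sq_sqrt (by linarith)
          have hk0 : 0 < √κ := sqrt_pos.2 (by linarith)
          -- On `x = 0` the minimum of `κ y³/3 - y` over `y ≥ 0` is `-2/(3√κ)`, which exceeds `h`
          -- because `κ d > 1`.
          have e : 0 ≤ (√κ * y - 1) ^ 2 * (√κ * y + 2) := by positivity
          have e2 : (√κ * y - 1) ^ 2 * (√κ * y + 2) = √κ * (√κ ^ 2 * y ^ 3 - 3 * y) + 2 := by ring
          rw [hk] at e2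
          nlinarith [mul_lt_mul_of_pos_left hp hk0]
        · have hy : y = 0 := le_antisymm (h1 h) h3
          subst hy
          have : 0 ≤ 2 / 3 * (κ - 1) * x ^ 3 := by
            have : 0 ≤ κ - 1 := by linarith
            positivity
          have : 0 < √d := sqrt_pos.2 hd0
          nlinarith) ⟨(1, 1), mem_connectedComponentIn h11, by simp⟩
        isPreconnected_connectedComponentIn
    intro p hp
    exact ⟨(this hp).1, (this hp).2, hsub hp⟩
  · exact (isPreconnected_quadrantRegion hκ hd0 hd1 hd).subset_connectedComponentIn
      ⟨by simp, by simp, h11⟩ (fun p hp => hp.2.2)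

/-! ### Moments over the region as iterated integrals in `(u, y)` -/

/-- The derivative of the coordinate change `(u, y) ↦ (u y, y)`. -/
noncomputable def blowDownDeriv (z : ℝ × ℝ) : ℝ × ℝ →L[ℝ] ℝ × ℝ :=
  LinearMap.toContinuousLinearMap (Matrix.toLin (Module.Basis.finTwoProd ℝ)
    (Module.Basis.finTwoProd ℝ) !![z.2, z.1; 0, 1])

theorem det_blowDownDeriv (z : ℝ × ℝ) : (blowDownDeriv z).det = z.2 := by
  simp only [blowDownDeriv, LinearMap.det_toContinuousLinearMap, LinearMap.det_toLin,
    Matrix.det_fin_two_of]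
  ring

theorem hasFDerivAt_blowDown (z : ℝ × ℝ) :
    HasFDerivAt (fun z : ℝ × ℝ => (z.1 * z.2, z.2)) (blowDownDeriv z) z := by
  unfold blowDownDeriv
  rw [Matrix.toLin_finTwoProd_toContinuousLinearMap]
  have h1 : HasFDerivAt (Prod.fst : ℝ × ℝ → ℝ) (ContinuousLinearMap.fst ℝ ℝ ℝ) z :=
    hasFDerivAt_fst
  have h2 : HasFDerivAt (Prod.snd : ℝ × ℝ → ℝ) (ContinuousLinearMap.snd ℝ ℝ ℝ) z :=
    hasFDerivAt_snd
  refine ((h1.mul h2).prodMk h2).congr_fderiv ?_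
  simp [add_comm]

/-- The region in the coordinates `(u, y)`, `x = u y`. -/
def blownRegion (κ h : ℝ) : Set (ℝ × ℝ) :=
  {z | 0 < z.1 ∧ 0 < z.2 ∧ H κ (z.1 * z.2, z.2) < h}

theorem image_blownRegion (κ h : ℝ) :
    (fun z : ℝ × ℝ => (z.1 * z.2, z.2)) '' blownRegion κ h = quadrantRegion κ h := by
  ext ⟨x, y⟩
  constructor
  · rintro ⟨⟨u, v⟩, ⟨h1, h2, h3⟩, h4⟩
    rw [← h4]
    exact ⟨mul_pos h1 h2, h2, h3⟩
  · rintro ⟨h1, h2, h3⟩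
    have h2' : y ≠ 0 := h2.ne'
    refine ⟨(x / y, y), ⟨div_pos h1 h2, h2, ?_⟩, ?_⟩
    · simpa [div_mul_cancel₀ _ h2'] using h3
    · simp [div_mul_cancel₀ _ h2']

theorem isOpen_blownRegion (κ h : ℝ) : IsOpen (blownRegion κ h) := by
  have hH : Continuous fun z : ℝ × ℝ => H κ (z.1 * z.2, z.2) := by unfold H; fun_prop
  exact (isOpen_lt continuous_const continuous_fst).inter
    ((isOpen_lt continuous_const continuous_snd).inter (isOpen_lt hH continuous_const))

theorem injOn_blowDown (κ h : ℝ) :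
    InjOn (fun z : ℝ × ℝ => (z.1 * z.2, z.2)) (blownRegion κ h) := by
  rintro ⟨u, y⟩ h1 ⟨v, w⟩ - h3
  simp only [Prod.mk.injEq] at h3
  obtain ⟨h3, rfl⟩ := h3
  rw [mul_right_cancel₀ (ne_of_gt h1.2.1) h3]

noncomputable def fibreLo (κ d u : ℝ) : ℝ :=
  (cos (third √(profile κ u * d)) - √3 * sin (third √(profile κ u * d))) / √(profile κ u)

noncomputable def fibreHi (κ d u : ℝ) : ℝ :=
  (cos (third √(profile κ u * d)) + √3 * sin (third √(profile κ u * d))) / √(profile κ u)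

theorem fibreLo_pos {κ d u : ℝ} (hκ : 1 < κ) (hd : 0 < d) (hu : 0 < u) : 0 < fibreLo κ d u := by
  have hp := one_le_profile hκ hu
  have hc0 : 0 < √(profile κ u * d) := sqrt_pos.2 (by nlinarith)
  have h1 := cos_third_gt hc0
  have h2 := sin_third_lt hc0
  have h3 : 0 < √3 := by positivity
  exact div_pos (by nlinarith) (sqrt_pos.2 (by linarith))

theorem fibreLo_le_fibreHi {κ d u : ℝ} (hκ : 1 < κ) (hd : 0 < d) (hu : 0 < u) :
    fibreLo κ d u ≤ fibreHi κ d u := by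
  have hp := one_le_profile hκ hu
  have hc0 : 0 < √(profile κ u * d) := sqrt_pos.2 (by nlinarith)
  have h2 := sin_third_nonneg hc0
  have h3 : 0 < √3 := by positivity
  unfold fibreLo fibreHi
  gcongr
  nlinarith [mul_nonneg h3.le h2]

theorem mem_blownRegion_iff {κ d u y : ℝ} (hκ : 1 < κ) (hd : 0 < d) :
    (u, y) ∈ blownRegion κ (-(2 / 3) * √d) ↔
      u ∈ ratios κ d ∧ y ∈ Ioo (fibreLo κ d u) (fibreHi κ d u) := by
  have key : 0 < u → 0 < y →
      (H κ (u * y, y) < -(2 / 3) * √d ↔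
        u ∈ ratios κ d ∧ y ∈ Ioo (fibreLo κ d u) (fibreHi κ d u)) := by
    intro hu hy
    have hp := one_le_profile hκ hu
    have hsp : 0 < √(profile κ u) := sqrt_pos.2 (by linarith)
    rw [H_mul, fibre_lt_iff (by linarith) hd hy]
    simp only [ratios, mem_ofPred_eq, hu, true_and, mem_Ioo, fibreLo, fibreHi,
      div_lt_iff₀ hsp, lt_div_iff₀ hsp, abs_lt]
    refine and_congr_right fun _ => and_congr ?_ ?_ <;> constructor <;> intro h <;> linarith
  constructor
  · rintro ⟨h1, h2, h3⟩
    exact (key h1 h2).1 h3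
  · rintro ⟨h1, h2⟩
    have hy : 0 < y := (fibreLo_pos hκ hd h1.1).trans h2.1
    exact ⟨h1.1, hy, (key h1.1 hy).2 ⟨h1, h2⟩⟩

theorem integrableOn_blownRegion {κ d : ℝ} (hκ : 1 < κ) (hd0 : 0 < d)
    (hd : 1 < κ * d) (i : ℤ) (n : ℕ) :
    IntegrableOn (fun z : ℝ × ℝ => z.1 ^ i * z.2 ^ n) (blownRegion κ (-(2 / 3) * √d)) := by
  -- Dropping the cubic term in `profile κ u * d < 1` leaves `u² > u₀²`. Ratios thus stay away from
  -- `0`, and `uⁱ` is bounded even for negative `i`.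
  set u₀ := √((κ * d - 1) / (3 * (κ - 1) * d)) with hu0
  have hq : 0 < κ - 1 := by linarith
  have hu0p : 0 < u₀ := sqrt_pos.2 (div_pos (by linarith) (by positivity))
  have hsub : blownRegion κ (-(2 / 3) * √d) ⊆ Icc u₀ (3 / 2) ×ˢ Icc (0 : ℝ) 2 := by
    rintro ⟨u, y⟩ h
    have hu := ((mem_blownRegion_iff hκ hd0).1 h).1
    obtain ⟨h1, h2, h3⟩ := h
    simp only at h1 h2
    rw [H_mul] at h3
    have hp := one_le_profile hκ h1
    refine ⟨⟨?_, (ratios_lt hκ hd0 hd hu).le⟩, h2.le, ?_⟩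
    · apply sqrt_le_iff.2 ⟨h1.le, ?_⟩
      rw [div_le_iff₀ (by positivity)]
      have e := hu.2
      unfold profile at e
      have : 0 ≤ (κ - 1) * u ^ 3 * d := by positivity
      nlinarith
    · by_contra h
      simp only [not_le] at h
      have : 0 < √d := sqrt_pos.2 hd0
      have h5 : y * (y ^ 2 / 3 - 1) ≤ y * (profile κ u * y ^ 2 / 3 - 1) := by
        gcongr; nlinarith [sq_nonneg y]
      nlinarith
  refine IntegrableOn.mono_set (ContinuousOn.integrableOn_compact
    (isCompact_Icc.prod isCompact_Icc) ?_) hsub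
  refine ContinuousOn.mul (continuousOn_fst.zpow₀ i ?_) (by fun_prop)
  rintro ⟨u, y⟩ ⟨h, -⟩
  exact Or.inl (ne_of_gt (hu0p.trans_le h.1))

/-- The Jacobian `y` turns `xⁱ yʲ` into `uⁱ y^(i+j+1)`. In all five moments used the exponent of `y`
is 0, 1 or 2, hence the natural number `n`. -/
theorem setIntegral_quadrantRegion {κ d : ℝ} (hκ : 1 < κ) (hd0 : 0 < d)
    (hd : 1 < κ * d) (i j : ℤ) (n : ℕ) (hn : i + j + 1 = n) :
    ∫ p in quadrantRegion κ (-(2 / 3) * √d), p.1 ^ i * p.2 ^ j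
      = ∫ u in ratios κ d, u ^ i * ∫ y in fibreLo κ d u..fibreHi κ d u, y ^ n := by
  have hR := (isOpen_blownRegion κ (-(2 / 3) * √d)).measurableSet
  have hG := integrableOn_blownRegion hκ hd0 hd i n
  have hS : MeasurableSet (ratios κ d) := by
    have hp : Continuous fun u => profile κ u * d := by unfold profile; fun_prop
    exact (isOpen_lt continuous_const continuous_id).measurableSet.inter
      (isOpen_lt hp continuous_const).measurableSet
  rw [← image_blownRegion, integral_image_eq_integral_abs_det_fderiv_smul volume hR
    (fun z _ => (hasFDerivAt_blowDown z).hasFDerivWithinAt) (injOn_blowDown _ _)]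
  have h1 : ∫ z in blownRegion κ (-(2 / 3) * √d), |(blowDownDeriv z).det| • 
      ((z.1 * z.2) ^ i * z.2 ^ j) = ∫ z in blownRegion κ (-(2 / 3) * √d), z.1 ^ i * z.2 ^ n := by
    refine setIntegral_congr_fun hR fun z hz => ?_
    have hz2 : z.2 ≠ 0 := ne_of_gt hz.2.1
    simp only [det_blowDownDeriv, abs_of_pos hz.2.1, smul_eq_mul]
    rw [mul_zpow, ← zpow_natCast z.2 n, ← hn, zpow_add₀ hz2, zpow_add₀ hz2, zpow_one]
    ring
  rw [h1, ← integral_indicator hR, Measure.volume_eq_prod, integral_prod _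
    ((integrable_indicator_iff hR).2 hG), ← integral_indicator hS]
  refine integral_congr_ae (Filter.Eventually.of_forall fun u => ?_)
  simp only
  by_cases hu : u ∈ ratios κ d
  · rw [indicator_of_mem hu, intervalIntegral.integral_of_le
      (fibreLo_le_fibreHi hκ hd0 hu.1), integral_Ioc_eq_integral_Ioo, ← integral_const_mul,
      ← integral_indicator measurableSet_Ioo]
    refine integral_congr_ae (Filter.Eventually.of_forall fun y => ?_)
    beta_reduce
    by_cases hy : y ∈ Ioo (fibreLo κ d u) (fibreHi κ d u)
    · rw [indicator_of_mem hy, indicator_of_mem ((mem_blownRegion_iff hκ hd0).2 ⟨hu, hy⟩)]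
    · have : (u, y) ∉ blownRegion κ (-(2 / 3) * √d) := fun h =>
        hy ((mem_blownRegion_iff hκ hd0).1 h).2
      rw [indicator_of_notMem hy, indicator_of_notMem this]
  · rw [indicator_of_notMem hu]
    refine integral_eq_zero_of_ae (Filter.Eventually.of_forall fun y => ?_)
    beta_reduce
    have : (u, y) ∉ blownRegion κ (-(2 / 3) * √d) := fun h =>
        hu ((mem_blownRegion_iff hκ hd0).1 h).1
    rw [indicator_of_notMem this, Pi.zero_apply]

theorem integral_fibre_zero (κ d u : ℝ) : ∫ y in fibreLo κ d u..fibreHi κ d u, y ^ 0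
    = 2 * √3 * sin (third √(profile κ u * d)) / √(profile κ u) := by
  simp only [pow_zero, intervalIntegral.integral_const, smul_eq_mul, mul_one, fibreHi, fibreLo]
  ring

theorem integral_fibre_one (κ d u : ℝ) : ∫ y in fibreLo κ d u..fibreHi κ d u, y ^ 1
    = 2 * √3 * sin (third √(profile κ u * d)) * cos (third √(profile κ u * d))
      / √(profile κ u) ^ 2 := by
  rw [integral_pow, fibreHi, fibreLo]
  norm_num
  ring

/-- The cube difference is `2√3 S (C² + S²)` up to scaling, so the second moment differs from the
fibre length only by a power of the profile. All moments therefore share one weight. -/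
theorem integral_fibre_two (κ d u : ℝ) : ∫ y in fibreLo κ d u..fibreHi κ d u, y ^ 2
    = 2 * √3 * sin (third √(profile κ u * d)) / √(profile κ u) ^ 3 := by
  have h3 : √3 ^ 3 = 3 * √3 := by rw [pow_succ, sq_sqrt (by norm_num)]
  have h := sin_sq_add_cos_sq (third √(profile κ u * d))
  rw [integral_pow, fibreHi, fibreLo]
  norm_num
  rw [div_pow, div_pow, ← sub_div, div_right_comm]
  congr 1
  linear_combination 2 / 3 * sin (third √(profile κ u * d)) ^ 3 * h3
    + 2 * √3 * sin (third √(profile κ u * d)) * h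

/-! ### Change of variable from the ratio to the angle -/

noncomputable def arcDeriv (r φ : ℝ) : ℝ := 2 / 3 * (r * cos φ / √(1 - (r * sin φ) ^ 2))

theorem hasDerivAt_ratioOf {r : ℝ} (hr0 : 0 ≤ r) (hr : r < 1) (φ : ℝ) :
    HasDerivAt (ratioOf r) (sin (π / 3 - arc r φ) * arcDeriv r φ) φ := by
  have h := abs_lt.1 (abs_mul_sin_lt hr0 hr φ)
  have h1 : HasDerivAt (arc r) (arcDeriv r φ) φ := by
    have := ((hasDerivAt_arcsin h.1.ne' h.2.ne).comp φ ((hasDerivAt_sin φ).const_mul r)).const_mul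
      (2 / 3)
    refine this.congr_deriv ?_
    rw [arcDeriv]; ring
  have h2 := ((h1.const_sub (π / 3)).cos).const_add (1 / 2)
  exact h2.congr_deriv (by ring)

theorem arcDeriv_nonneg {r φ : ℝ} (hr0 : 0 ≤ r) (hφ : φ ∈ Ioo (-(π / 2)) (π / 2)) :
    0 ≤ arcDeriv r φ := by
  have := (cos_pos_of_mem_Ioo hφ).le
  unfold arcDeriv; positivity

theorem setIntegral_ratios {κ d r : ℝ} (hκ : 1 < κ) (hd0 : 0 < d) (hd : 1 < κ * d) (hr0 : 0 < r)
    (hr1 : r < 1) (hr : (κ - 1) * r ^ 2 * d = 1 - d) (f : ℝ → ℝ) :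
    ∫ u in ratios κ d, f u = ∫ φ in (-(π / 2))..(π / 2),
      sin (π / 3 - arc r φ) * arcDeriv r φ * f (ratioOf r φ) := by
  rw [← image_ratioOf hκ hd0 hd hr0 hr, integral_image_eq_integral_abs_deriv_smul measurableSet_Ioo
    (fun φ _ => (hasDerivAt_ratioOf hr0.le hr1 φ).hasDerivWithinAt) (injOn_ratioOf hr0 hr1),
    intervalIntegral.integral_of_le (by linarith [pi_pos]), integral_Ioc_eq_integral_Ioo]
  refine setIntegral_congr_fun measurableSet_Ioo fun φ hφ => ?_
  have h := arc_mem hr0.le hr1 φ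
  simp only [smul_eq_mul]
  rw [abs_of_nonneg (mul_nonneg (sin_nonneg_of_nonneg_of_le_pi (by linarith [h.2])
    (by linarith [h.1, pi_pos])) (arcDeriv_nonneg hr0.le hφ))]

/-! ### Trisection and even parts in the angle -/

/-- The squared sine of a third of the angle whose squared sine is `x`. -/
noncomputable def trisect (x : ℝ) : ℝ := sin (arcsin √x / 3) ^ 2

theorem cos_arc (r φ : ℝ) : cos (arc r φ) = 1 - 2 * trisect ((r * sin φ) ^ 2) := by
  have h : sin (arcsin √((r * sin φ) ^ 2) / 3) ^ 2 = sin (arcsin (r * sin φ) / 3) ^ 2 := by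
    rw [sqrt_sq_eq_abs]
    rcases abs_choice (r * sin φ) with h | h <;> rw [h]
    rw [arcsin_neg, neg_div, sin_neg, neg_sq]
  rw [trisect, h, arc, show 2 / 3 * arcsin (r * sin φ) = 2 * (arcsin (r * sin φ) / 3) by ring,
    cos_two_mul, cos_sq']
  ring

theorem third_sqrt_one_sub {x : ℝ} (h0 : 0 ≤ x) : third √(1 - x) = arcsin √x / 3 := by
  rw [third, arcsin_eq_arccos (sqrt_nonneg x), sq_sqrt h0]

theorem sin_third_mul {x : ℝ} (h1 : x ≤ 1) :
    sin (arcsin √x / 3) * (3 - 4 * trisect x) = √x := by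
  have h := sin_three_mul (arcsin √x / 3)
  rw [mul_div_cancel₀ _ (by norm_num : (3 : ℝ) ≠ 0),
    sin_arcsin (by linarith [sqrt_nonneg x]) (sqrt_le_one.2 h1)] at h
  unfold trisect; linarith

theorem trisect_nonneg (x : ℝ) : 0 ≤ trisect x := sq_nonneg _

theorem trisect_le {x : ℝ} : trisect x ≤ 1 / 4 := by
  have h1 := arcsin_le_pi_div_two √x
  have h0 := arcsin_nonneg.2 (sqrt_nonneg x)
  have h2 : sin (arcsin √x / 3) ≤ sin (π / 6) :=
    sin_le_sin_of_le_of_le_pi_div_two (by linarith [pi_pos]) (by linarith [pi_pos]) (by linarith)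
  have h3 : 0 ≤ sin (arcsin √x / 3) :=
    sin_nonneg_of_nonneg_of_le_pi (by linarith) (by linarith [pi_pos])
  rw [sin_pi_div_six] at h2
  unfold trisect
  nlinarith

theorem trisect_eq {x : ℝ} (h0 : 0 ≤ x) (h1 : x ≤ 1) :
    trisect x * (3 - 4 * trisect x) ^ 2 = x := by
  have h := sin_third_mul h1
  calc trisect x * (3 - 4 * trisect x) ^ 2
      = (sin (arcsin √x / 3) * (3 - 4 * trisect x)) ^ 2 := by rw [trisect]; ring
    _ = x := by rw [h, sq_sqrt h0]

theorem cos_third_mul_cos {x : ℝ} (h0 : 0 ≤ x) :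
    cos (third √(1 - x)) * √(1 - x) = 1 - (5 * trisect x - 4 * trisect x ^ 2) := by
  have h := cos_three_third (sqrt_nonneg (1 - x)) (sqrt_le_one.2 (by linarith))
  have h2 : cos (third √(1 - x)) ^ 2 = 1 - trisect x := by
    rw [third_sqrt_one_sub h0, trisect, cos_sq']
  nth_rewrite 2 [← h]
  have : cos (third √(1 - x)) * (4 * cos (third √(1 - x)) ^ 3 - 3 * cos (third √(1 - x)))
    = 4 * (cos (third √(1 - x)) ^ 2) ^ 2 - 3 * cos (third √(1 - x)) ^ 2 := by ring
  rw [this, h2]; ring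

theorem trisect_lt {x : ℝ} (h0 : 0 ≤ x) (h1 : x < 1) : trisect x < 1 / 4 := by
  refine lt_of_le_of_ne trisect_le fun h => ?_
  have := trisect_eq h0 h1.le
  rw [h] at this
  norm_num at this
  linarith

/-- The integrand of the generating function in the angular variable, in terms of
`a = trisect x` and `k = 1 - 2 trisect y`. -/
noncomputable def kernel (b₀ b₁ b₂ b₃ x y : ℝ) : ℝ :=
  1 / ((3 - 4 * trisect x) * √(1 - x) ^ 3 * √(1 - y)) *
    (b₀ * (1 - 2 * trisect y)
      + b₁ * ((5 * trisect x - 4 * trisect x ^ 2) * (1 - 2 * trisect y))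
      + b₂ * (2 * trisect y * (3 - 4 * trisect y))
      + b₃ * ((5 * trisect x - 4 * trisect x ^ 2) *
          (2 * trisect y * (3 - 4 * trisect y) / (1 - 4 * trisect y))))

theorem even_part_one (t : ℝ) : sin (π / 3 - t) + sin (π / 3 + t) = √3 * cos t := by
  rw [sin_sub, sin_add, sin_pi_div_three]; ring

theorem even_part_ratio (t : ℝ) : (1 / 2 + cos (π / 3 - t)) * sin (π / 3 - t)
    + (1 / 2 + cos (π / 3 + t)) * sin (π / 3 + t) = √3 / 2 * (cos t + 2 * cos t ^ 2 - 1) := by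
  rw [sin_sub, sin_add, cos_sub, cos_add, sin_pi_div_three, cos_pi_div_three]
  have := sin_sq_add_cos_sq t
  linear_combination - √3 / 2 * this

/-- The product of the two denominators is `(1 + cos t)(2 cos t - 1)/2`, and the factor `1 + cos t`
cancels against the numerator. -/
theorem even_part_inv {t : ℝ} (h1 : 1 / 2 + cos (π / 3 - t) ≠ 0) (h2 : 1 / 2 + cos (π / 3 + t) ≠ 0)
    (h3 : 2 * cos t - 1 ≠ 0) : (1 / 2 + cos (π / 3 - t))⁻¹ * sin (π / 3 - t)
    + (1 / 2 + cos (π / 3 + t))⁻¹ * sin (π / 3 + t) = √3 / (2 * cos t - 1) := by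
  rw [inv_mul_eq_div, inv_mul_eq_div, div_add_div _ _ h1 h2, div_eq_div_iff (mul_ne_zero h1 h2) h3]
  rw [sin_sub, sin_add, cos_sub, cos_add, sin_pi_div_three, cos_pi_div_three]
  have h := sin_sq_add_cos_sq t
  have h3 : √3 ^ 2 = 3 := by norm_num
  have hs : sin t ^ 2 = 1 - cos t ^ 2 := by linarith
  ring_nf
  rw [show √3 ^ 3 = 3 * √3 by rw [pow_succ, h3], hs]
  ring

theorem integral_symmetrize {f : ℝ → ℝ} (hf : Continuous f) (b : ℝ) :
    ∫ φ in (-b)..b, f φ = ∫ φ in (-b)..b, (f φ + f (-φ)) / 2 := by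
  have h1 : ∫ φ in (-b)..b, f (-φ) = ∫ φ in (-b)..b, f φ := by
    rw [intervalIntegral.integral_comp_neg, neg_neg]
  rw [intervalIntegral.integral_div, intervalIntegral.integral_add (hf.intervalIntegrable _ _)
    (Continuous.intervalIntegrable (by fun_prop) _ _), h1]
  ring

/-! ### The generating function as an integral of the kernel -/

section
variable {κ d r : ℝ}

/-- The even part of the common factor of the pulled back integrands. -/
noncomputable def weight (d r φ : ℝ) : ℝ :=
  arcDeriv r φ * (2 * √3 * sin (third √(1 - (1 - d) * cos φ ^ 2)) * √d ^ 3
    / √(1 - (1 - d) * cos φ ^ 2) ^ 3)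

theorem profile_ratioOf_mul (hr0 : 0 < r) (hr1 : r < 1)
    (hr : (κ - 1) * r ^ 2 * d = 1 - d) (φ : ℝ) :
    profile κ (ratioOf r φ) * d = 1 - (1 - d) * cos φ ^ 2 := by
  rw [profile_ratioOf κ hr0.le hr1, cos_sq', ← hr]
  linear_combination hr

theorem one_sub_pos (hd0 : 0 < d) (hd1 : d < 1) (φ : ℝ) : 0 < 1 - (1 - d) * cos φ ^ 2 := by
  nlinarith [cos_sq_le_one φ, sq_nonneg (cos φ)]

theorem continuous_arc (r : ℝ) : Continuous (arc r) := by unfold arc; fun_prop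

theorem continuous_ratioOf (r : ℝ) : Continuous (ratioOf r) := by unfold ratioOf arc; fun_prop

theorem continuous_third : Continuous third := by unfold third; fun_prop

theorem continuous_arcDeriv (hr0 : 0 < r) (hr1 : r < 1) : Continuous (arcDeriv r) := by
  unfold arcDeriv
  refine continuous_const.mul (Continuous.div (by fun_prop) (by fun_prop) fun φ => ?_)
  have := abs_lt.1 (abs_mul_sin_lt hr0.le hr1 φ)
  exact (sqrt_pos.2 (by nlinarith)).ne'

theorem continuous_weight (hd0 : 0 < d) (hd1 : d < 1) (hr0 : 0 < r) (hr1 : r < 1) :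
    Continuous (weight d r) := by
  have h1 := continuous_arcDeriv hr0 hr1
  have h2 := continuous_third
  unfold weight
  refine h1.mul (Continuous.div (by fun_prop) (by fun_prop) fun φ => ?_)
  exact pow_ne_zero _ (sqrt_pos.2 (one_sub_pos hd0 hd1 φ)).ne'

theorem Iij_eq (hκ : 1 < κ) (hd0 : 0 < d) (hd1 : d < 1) (hd : 1 < κ * d) (hr0 : 0 < r)
    (hr1 : r < 1) (hr : (κ - 1) * r ^ 2 * d = 1 - d) (i j : ℤ) (n : ℕ) (hn : i + j + 1 = n) :
    Iij κ i j (-(2 / 3) * √d) = ∫ φ in (-(π / 2))..(π / 2),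
      sin (π / 3 - arc r φ) * arcDeriv r φ * ((ratioOf r φ) ^ i *
        ∫ y in fibreLo κ d (ratioOf r φ)..fibreHi κ d (ratioOf r φ), y ^ n) := by
  rw [Iij, region_eq hκ hd0 hd1 hd, setIntegral_quadrantRegion hκ hd0 hd i j n hn,
    setIntegral_ratios hκ hd0 hd hr0 hr1 hr]

theorem sqrt_profile_ratioOf (hd0 : 0 < d) (hr0 : 0 < r) (hr1 : r < 1)
    (hr : (κ - 1) * r ^ 2 * d = 1 - d) (φ : ℝ) :
    √(profile κ (ratioOf r φ)) = √(1 - (1 - d) * cos φ ^ 2) / √d := by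
  rw [← profile_ratioOf_mul hr0 hr1 hr φ, sqrt_mul' _ hd0.le,
    mul_div_cancel_right₀ _ (sqrt_pos.2 hd0).ne']

theorem genH_eq_integral (hκ : 1 < κ) (hd0 : 0 < d) (hd1 : d < 1) (hd : 1 < κ * d) (hr0 : 0 < r)
    (hr1 : r < 1) (hr : (κ - 1) * r ^ 2 * d = 1 - d) (μ₁ μ₂ μ₃ μ₄ : ℝ) :
    genH κ μ₁ μ₂ μ₃ μ₄ (-(2 / 3) * √d) = ∫ φ in (-(π / 2))..(π / 2),
      sin (π / 3 - arc r φ) * weight d r φ *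
        (μ₁ * (-(2 / 3) * (cos (third √(1 - (1 - d) * cos φ ^ 2)) * √(1 - (1 - d) * cos φ ^ 2)))
          + μ₂ * ratioOf r φ + μ₃
          + μ₄ * ((ratioOf r φ)⁻¹ * (2 * profile κ (ratioOf r φ)
            - 2 * κ * (cos (third √(1 - (1 - d) * cos φ ^ 2))
              * √(1 - (1 - d) * cos φ ^ 2))))) := by
  have hw := continuous_weight hd0 hd1 hr0 hr1
  have ha := continuous_arc r
  have hu := continuous_ratioOf r
  have ht := continuous_third
  have hui : Continuous fun φ => (ratioOf r φ)⁻¹ :=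
    hu.inv₀ fun φ => (ratioOf_pos hr0.le hr1 φ).ne'
  have hp : Continuous fun φ => profile κ (ratioOf r φ) := by unfold profile; fun_prop
  have hsd : √d ≠ 0 := (sqrt_pos.2 hd0).ne'
  have hsc : ∀ φ, √(1 - (1 - d) * cos φ ^ 2) ≠ 0 := fun φ =>
    (sqrt_pos.2 (one_sub_pos hd0 hd1 φ)).ne'
  have e1 : -(2 / 3) * √d * Iij κ 0 0 (-(2 / 3) * √d) = ∫ φ in (-(π / 2))..(π / 2),
      sin (π / 3 - arc r φ) * weight d r φ *
        (-(2 / 3) * (cos (third √(1 - (1 - d) * cos φ ^ 2)) * √(1 - (1 - d) * cos φ ^ 2))) := by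
    rw [Iij_eq hκ hd0 hd1 hd hr0 hr1 hr 0 0 1 (by norm_num),
      ← intervalIntegral.integral_const_mul]
    congr 1; ext φ
    rw [integral_fibre_one, sqrt_profile_ratioOf hd0 hr0 hr1 hr, profile_ratioOf_mul hr0 hr1 hr,
      weight]
    have := hsc φ
    simp only [zpow_zero]
    field_simp
  have e2 : Iij κ 1 0 (-(2 / 3) * √d) = ∫ φ in (-(π / 2))..(π / 2),
      sin (π / 3 - arc r φ) * weight d r φ * ratioOf r φ := by
    rw [Iij_eq hκ hd0 hd1 hd hr0 hr1 hr 1 0 2 (by norm_num)]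
    congr 1; ext φ
    rw [integral_fibre_two, sqrt_profile_ratioOf hd0 hr0 hr1 hr, profile_ratioOf_mul hr0 hr1 hr,
      weight]
    have := hsc φ
    simp only [zpow_one]
    field_simp
  have e3 : Iij κ 0 1 (-(2 / 3) * √d) = ∫ φ in (-(π / 2))..(π / 2),
      sin (π / 3 - arc r φ) * weight d r φ := by
    rw [Iij_eq hκ hd0 hd1 hd hr0 hr1 hr 0 1 2 (by norm_num)]
    congr 1; ext φ
    rw [integral_fibre_two, sqrt_profile_ratioOf hd0 hr0 hr1 hr, profile_ratioOf_mul hr0 hr1 hr,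
      weight]
    have := hsc φ
    simp only [zpow_zero]
    field_simp
  have e4 : Iij κ (-1) 0 (-(2 / 3) * √d) = ∫ φ in (-(π / 2))..(π / 2),
      sin (π / 3 - arc r φ) * weight d r φ *
        ((ratioOf r φ)⁻¹ * profile κ (ratioOf r φ)) := by
    rw [Iij_eq hκ hd0 hd1 hd hr0 hr1 hr (-1) 0 0 (by norm_num)]
    congr 1; ext φ
    have hpp : profile κ (ratioOf r φ) = (√(1 - (1 - d) * cos φ ^ 2) / √d) ^ 2 := by
      rw [← sqrt_profile_ratioOf hd0 hr0 hr1 hr, sq_sqrt]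
      linarith [one_le_profile hκ (ratioOf_pos hr0.le hr1 φ)]
    rw [integral_fibre_zero, sqrt_profile_ratioOf hd0 hr0 hr1 hr, profile_ratioOf_mul hr0 hr1 hr,
      hpp, weight]
    have := hsc φ
    simp only [zpow_neg_one]
    field_simp
  have e5 : 3 * κ * (-(2 / 3) * √d) * Iij κ (-1) 1 (-(2 / 3) * √d) = ∫ φ in (-(π / 2))..(π / 2),
      sin (π / 3 - arc r φ) * weight d r φ *
        ((ratioOf r φ)⁻¹ * (-2 * κ * (cos (third √(1 - (1 - d) * cos φ ^ 2))
              * √(1 - (1 - d) * cos φ ^ 2)))) := by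
    rw [Iij_eq hκ hd0 hd1 hd hr0 hr1 hr (-1) 1 1 (by norm_num),
      ← intervalIntegral.integral_const_mul]
    congr 1; ext φ
    rw [integral_fibre_one, sqrt_profile_ratioOf hd0 hr0 hr1 hr, profile_ratioOf_mul hr0 hr1 hr,
      weight]
    have := hsc φ
    simp only [zpow_neg_one]
    field_simp
  rw [genH, mul_assoc μ₁, e1, e2, e3, e4, e5]
  simp only [← intervalIntegral.integral_const_mul]
  rw [← intervalIntegral.integral_add, ← intervalIntegral.integral_add,
    ← intervalIntegral.integral_add, ← intervalIntegral.integral_const_mul,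
    ← intervalIntegral.integral_add]
  · congr 1; ext φ; ring
  all_goals exact Continuous.intervalIntegrable (by fun_prop) _ _

/-- Write `k = cos (arc r φ)`, `e = 5a - 4a²` with `a` the trisection of the radial argument, and `B
= (1-k)(1+2k)`. The `μ₄` bracket is `(2P - 2κ(1-e))/(2k-1) = 2κe/(2k-1) - (κ-1)(1+k)(2k-1)`: its
particular combination of moments leaves a pole only in the term with the small factor `e`. The
identities `1/(2k-1) = k + B/(2k-1)` and `(1+k)(2k-1) = 2k - B` then express everything through `k`,
`e k`, `B` and `e B/(2k-1)`. -/
theorem genH_eq_kernel (hκ : 1 < κ) (hd0 : 0 < d) (hd1 : d < 1) (hd : 1 < κ * d) (hr0 : 0 < r)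
    (hr1 : r < 1) (hr : (κ - 1) * r ^ 2 * d = 1 - d) (μ₁ μ₂ μ₃ μ₄ : ℝ) :
    genH κ μ₁ μ₂ μ₃ μ₄ (-(2 / 3) * √d) = 2 * √d ^ 3 * √(1 - d) * r * ∫ φ in (-(π / 2))..(π / 2),
      cos φ ^ 2 * kernel (-(2 / 3) * μ₁ + μ₂ + μ₃ - 2 * (κ - 1) * μ₄) (2 / 3 * μ₁ + 2 * κ * μ₄)
        ((κ - 1) * μ₄ - μ₂ / 2) (2 * κ * μ₄) ((1 - d) * cos φ ^ 2) ((r * sin φ) ^ 2) := by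
  have hw := continuous_weight hd0 hd1 hr0 hr1
  have ha := continuous_arc r
  have hu := continuous_ratioOf r
  have ht := continuous_third
  have hui : Continuous fun φ => (ratioOf r φ)⁻¹ :=
    hu.inv₀ fun φ => (ratioOf_pos hr0.le hr1 φ).ne'
  have hp : Continuous fun φ => profile κ (ratioOf r φ) := by unfold profile; fun_prop
  rw [genH_eq_integral hκ hd0 hd1 hd hr0 hr1 hr, integral_symmetrize (by fun_prop),
    ← intervalIntegral.integral_const_mul]
  refine intervalIntegral.integral_congr fun φ hφ => ?_
  rw [uIcc_of_le (by linarith [pi_pos])] at hφ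
  have harc : arc r (-φ) = -arc r φ := by simp [arc]
  have hwt : weight d r (-φ) = weight d r φ := by simp [weight, arcDeriv]
  have hrat : ratioOf r (-φ) = 1 / 2 + cos (π / 3 + arc r φ) := by
    rw [ratioOf, harc, sub_neg_eq_add]
  have hprof : profile κ (ratioOf r (-φ)) = profile κ (ratioOf r φ) := by
    rw [profile_ratioOf κ hr0.le hr1, profile_ratioOf κ hr0.le hr1, sin_neg]; ring
  have h1 := ratioOf_pos hr0.le hr1 φ
  have h2 := ratioOf_pos hr0.le hr1 (-φ)
  have hy := abs_lt.1 (abs_mul_sin_lt hr0.le hr1 φ)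
  have hx0 : 0 ≤ (1 - d) * cos φ ^ 2 := mul_nonneg (by linarith) (sq_nonneg _)
  have hx1 := one_sub_pos hd0 hd1 φ
  have hk := trisect_lt (sq_nonneg (r * sin φ)) (by nlinarith)
  have hcos := cos_arc r φ
  have h3 : 2 * cos (arc r φ) - 1 ≠ 0 := by rw [hcos]; exact ne_of_gt (by linarith)
  have hpe : profile κ (ratioOf r φ)
      = κ - (κ - 1) / 2 * ((1 + cos (arc r φ)) * (2 * cos (arc r φ) - 1) ^ 2) := by
    rw [profile_ratioOf κ hr0.le hr1, hcos]
    linear_combination (-(κ - 1)) * trisect_eq (sq_nonneg (r * sin φ)) (by nlinarith)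
  have s1 := even_part_one (arc r φ)
  have s2 := even_part_ratio (arc r φ)
  have s3 := even_part_inv (t := arc r φ) h1.ne' (hrat ▸ h2.ne') h3
  have hcc := cos_third_mul_cos hx0
  rw [← hrat] at s2 s3
  rw [harc, hwt, hprof, cos_neg, sub_neg_eq_add, hcc]
  rw [show 1 / 2 + cos (π / 3 - arc r φ) = ratioOf r φ from rfl] at s2 s3
  set P := profile κ (ratioOf r φ)
  set e := 5 * trisect ((1 - d) * cos φ ^ 2) - 4 * trisect ((1 - d) * cos φ ^ 2) ^ 2 with he
  set W := weight d r φ with hW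
  have hsin : sin (third √(1 - (1 - d) * cos φ ^ 2))
      = √(1 - d) * cos φ / (3 - 4 * trisect ((1 - d) * cos φ ^ 2)) := by
    have := trisect_le (x := (1 - d) * cos φ ^ 2)
    rw [eq_div_iff (by linarith), third_sqrt_one_sub hx0, sin_third_mul (by linarith),
      sqrt_mul (by linarith), sqrt_sq (cos_nonneg_of_mem_Icc hφ)]
  -- One factor `cos φ` comes from `arcDeriv`, the other from the sine of the third angle; likewise
  -- `r` and `√(1-d)` come out.
  have hWe : W * √3 = 2 * (2 * √d ^ 3 * √(1 - d) * r * cos φ ^ 2 *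
      (1 / ((3 - 4 * trisect ((1 - d) * cos φ ^ 2)) * √(1 - (1 - d) * cos φ ^ 2) ^ 3
        * √(1 - (r * sin φ) ^ 2)))) := by
    have h33 : √3 * √3 = 3 := by norm_num
    rw [hW, weight, arcDeriv, hsin]
    simp only [div_eq_mul_inv, mul_inv, one_mul]
    linear_combination (4 / 3 * r * cos φ ^ 2 * (√(1 - (r * sin φ) ^ 2))⁻¹ * √(1 - d) *
      (3 - 4 * trisect ((1 - d) * cos φ ^ 2))⁻¹ * √d ^ 3 *
        (√(1 - (1 - d) * cos φ ^ 2) ^ 3)⁻¹) * h33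
  set k := cos (arc r φ) with hkdef
  have hbr : 1 - 2 * trisect ((r * sin φ) ^ 2) = k := hcos.symm
  have htri : trisect ((r * sin φ) ^ 2) = (1 - k) / 2 := by linarith
  have hLHS : (sin (π / 3 - arc r φ) * W * (μ₁ * (-(2 / 3) * (1 - e)) + μ₂ * ratioOf r φ + μ₃
        + μ₄ * ((ratioOf r φ)⁻¹ * (2 * P - 2 * κ * (1 - e))))
      + sin (π / 3 + arc r φ) * W * (μ₁ * (-(2 / 3) * (1 - e)) + μ₂ * ratioOf r (-φ) + μ₃
        + μ₄ * ((ratioOf r (-φ))⁻¹ * (2 * P - 2 * κ * (1 - e))))) / 2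
      = W * √3 / 2 * (μ₁ * (-(2 / 3) * (1 - e)) * k + μ₂ * ((k + 2 * k ^ 2 - 1) / 2) + μ₃ * k
        + μ₄ * ((2 * P - 2 * κ * (1 - e)) / (2 * k - 1))) := by
    linear_combination W / 2 * ((μ₁ * (-(2 / 3) * (1 - e)) + μ₃) * s1 + μ₂ * s2
      + μ₄ * (2 * P - 2 * κ * (1 - e)) * s3)
  rw [hLHS, hWe, kernel, ← he, htri, hpe]
  have h4 : 1 - 4 * ((1 - k) / 2) = 2 * k - 1 := by ring
  rw [h4]
  generalize 1 / ((3 - 4 * trisect ((1 - d) * cos φ ^ 2)) * √(1 - (1 - d) * cos φ ^ 2) ^ 3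
        * √(1 - (r * sin φ) ^ 2)) = Q
  field_simp
  ring

end

/-! ### Calculus of third-order expansions with uniform remainder -/

/-- `f = c₀ + c₁ d + c₂ d² + c₃ d³ + O(d⁴)` along `l`, with bounded coefficients. -/
structure HasExpansion {α : Type*} (l : Filter α) (d f c₀ c₁ c₂ c₃ : α → ℝ) : Prop where
  bdd₀ : c₀ =O[l] fun _ => (1 : ℝ)
  bdd₁ : c₁ =O[l] fun _ => (1 : ℝ)
  bdd₂ : c₂ =O[l] fun _ => (1 : ℝ)
  bdd₃ : c₃ =O[l] fun _ => (1 : ℝ)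
  approx : (fun z => f z - (c₀ z + c₁ z * d z + c₂ z * d z ^ 2 + c₃ z * d z ^ 3))
    =O[l] fun z => d z ^ 4

theorem isBigO_one_mul {α : Type*} {l : Filter α} {f g : α → ℝ}
    (hf : f =O[l] fun _ => (1 : ℝ)) (hg : g =O[l] fun _ => (1 : ℝ)) :
    (fun z => f z * g z) =O[l] fun _ => (1 : ℝ) := by
  simpa using hf.mul hg

namespace HasExpansion

variable {α : Type*} {l : Filter α} {d f g a₀ a₁ a₂ a₃ b₀ b₁ b₂ b₃ c₀ c₁ c₂ c₃ : α → ℝ}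

theorem congr_coeff (h : HasExpansion l d f a₀ a₁ a₂ a₃) (h₀ : ∀ z, a₀ z = b₀ z)
    (h₁ : ∀ z, a₁ z = b₁ z) (h₂ : ∀ z, a₂ z = b₂ z) (h₃ : ∀ z, a₃ z = b₃ z) :
    HasExpansion l d f b₀ b₁ b₂ b₃ := by
  obtain rfl := funext h₀
  obtain rfl := funext h₁
  obtain rfl := funext h₂
  obtain rfl := funext h₃
  exact h

theorem of_bdd (h : c₀ =O[l] fun _ => (1 : ℝ)) :
    HasExpansion l d c₀ c₀ (fun _ => 0) (fun _ => 0) (fun _ => 0) :=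
  ⟨h, isBigO_zero _ _, isBigO_zero _ _, isBigO_zero _ _, by simpa using isBigO_zero _ _⟩

theorem const (c : ℝ) :
    HasExpansion l d (fun _ => c) (fun _ => c) (fun _ => 0) (fun _ => 0) (fun _ => 0) :=
  of_bdd (isBigO_const_const _ one_ne_zero _)

theorem id : HasExpansion l d d (fun _ => 0) (fun _ => 1) (fun _ => 0) (fun _ => 0) :=
  ⟨isBigO_zero _ _, isBigO_const_const _ one_ne_zero _, isBigO_zero _ _, isBigO_zero _ _,
    by simpa using isBigO_zero _ _⟩

theorem add (hf : HasExpansion l d f a₀ a₁ a₂ a₃) (hg : HasExpansion l d g b₀ b₁ b₂ b₃) :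
    HasExpansion l d (fun z => f z + g z) (fun z => a₀ z + b₀ z) (fun z => a₁ z + b₁ z)
      (fun z => a₂ z + b₂ z) (fun z => a₃ z + b₃ z) :=
  ⟨hf.bdd₀.add hg.bdd₀, hf.bdd₁.add hg.bdd₁, hf.bdd₂.add hg.bdd₂, hf.bdd₃.add hg.bdd₃,
    (hf.approx.add hg.approx).congr_left fun z => by ring⟩

theorem bdd_poly (hd : d =O[l] fun _ => (1 : ℝ)) (hf : HasExpansion l d f a₀ a₁ a₂ a₃) :
    (fun z => a₀ z + a₁ z * d z + a₂ z * d z ^ 2 + a₃ z * d z ^ 3) =O[l] fun _ => (1 : ℝ) := by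
  have h2 : (fun z => d z ^ 2) =O[l] fun _ => (1 : ℝ) := by simpa using hd.pow 2
  have h3 : (fun z => d z ^ 3) =O[l] fun _ => (1 : ℝ) := by simpa using hd.pow 3
  exact ((hf.bdd₀.add (isBigO_one_mul hf.bdd₁ hd)).add (isBigO_one_mul hf.bdd₂ h2)).add
    (isBigO_one_mul hf.bdd₃ h3)

theorem bdd (hd : d =O[l] fun _ => (1 : ℝ)) (hf : HasExpansion l d f a₀ a₁ a₂ a₃) :
    f =O[l] fun _ => (1 : ℝ) := by
  have h4 : (fun z => d z ^ 4) =O[l] fun _ => (1 : ℝ) := by simpa using hd.pow 4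
  exact ((hf.approx.trans h4).add (hf.bdd_poly hd)).congr_left fun z => by ring

theorem mul (hd : d =O[l] fun _ => (1 : ℝ)) (hf : HasExpansion l d f a₀ a₁ a₂ a₃)
    (hg : HasExpansion l d g b₀ b₁ b₂ b₃) :
    HasExpansion l d (fun z => f z * g z) (fun z => a₀ z * b₀ z)
      (fun z => a₀ z * b₁ z + a₁ z * b₀ z)
      (fun z => a₀ z * b₂ z + a₁ z * b₁ z + a₂ z * b₀ z)
      (fun z => a₀ z * b₃ z + a₁ z * b₂ z + a₂ z * b₁ z + a₃ z * b₀ z) := by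
  have h2 : (fun z => d z ^ 2) =O[l] fun _ => (1 : ℝ) := by simpa using hd.pow 2
  have tail : (fun z => (a₁ z * b₃ z + a₂ z * b₂ z + a₃ z * b₁ z
      + (a₂ z * b₃ z + a₃ z * b₂ z) * d z + a₃ z * b₃ z * d z ^ 2)) =O[l] fun _ => (1 : ℝ) :=
    (((((isBigO_one_mul hf.bdd₁ hg.bdd₃).add (isBigO_one_mul hf.bdd₂ hg.bdd₂)).add
      (isBigO_one_mul hf.bdd₃ hg.bdd₁))).add (isBigO_one_mul
        ((isBigO_one_mul hf.bdd₂ hg.bdd₃).add (isBigO_one_mul hf.bdd₃ hg.bdd₂)) hd)).add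
          (isBigO_one_mul (isBigO_one_mul hf.bdd₃ hg.bdd₃) h2)
  have t1 := tail.mul (isBigO_refl (fun z => d z ^ 4) l)
  have t2 := (hf.bdd hd).mul hg.approx
  have t3 := (hg.bdd_poly hd).mul hf.approx
  simp only [one_mul] at t1 t2 t3
  refine ⟨isBigO_one_mul hf.bdd₀ hg.bdd₀,
    (isBigO_one_mul hf.bdd₀ hg.bdd₁).add (isBigO_one_mul hf.bdd₁ hg.bdd₀),
    ((isBigO_one_mul hf.bdd₀ hg.bdd₂).add (isBigO_one_mul hf.bdd₁ hg.bdd₁)).add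
      (isBigO_one_mul hf.bdd₂ hg.bdd₀),
    (((isBigO_one_mul hf.bdd₀ hg.bdd₃).add (isBigO_one_mul hf.bdd₁ hg.bdd₂)).add
      (isBigO_one_mul hf.bdd₂ hg.bdd₁)).add (isBigO_one_mul hf.bdd₃ hg.bdd₀), ?_⟩
  exact ((t2.add t3).add t1).congr_left fun z => by ring

theorem const_mul (hd : d =O[l] fun _ => (1 : ℝ)) (c : ℝ)
    (hf : HasExpansion l d f a₀ a₁ a₂ a₃) :
    HasExpansion l d (fun z => c * f z) (fun z => c * a₀ z) (fun z => c * a₁ z)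
      (fun z => c * a₂ z) (fun z => c * a₃ z) :=
  ((const c).mul hd hf).congr_coeff (fun z => by ring) (fun z => by ring) (fun z => by ring)
    (fun z => by ring)

/-- The coefficients of a reciprocal are found by solving a triangular system. -/
theorem inv (hd : d =O[l] fun _ => (1 : ℝ)) (hf : HasExpansion l d f a₀ a₁ a₂ a₃) {m : ℝ}
    (hm : 0 < m) (hlow : ∀ᶠ z in l, m ≤ f z) (k₀ k₁ k₂ k₃ : ℝ) (h₀ : ∀ z, a₀ z * k₀ = 1)
    (h₁ : ∀ z, a₀ z * k₁ + a₁ z * k₀ = 0) (h₂ : ∀ z, a₀ z * k₂ + a₁ z * k₁ + a₂ z * k₀ = 0)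
    (h₃ : ∀ z, a₀ z * k₃ + a₁ z * k₂ + a₂ z * k₁ + a₃ z * k₀ = 0) :
    HasExpansion l d (fun z => 1 / f z) (fun _ => k₀) (fun _ => k₁) (fun _ => k₂)
      (fun _ => k₃) := by
  have hb : ∀ k : ℝ, (fun _ : α => k) =O[l] fun _ => (1 : ℝ) := fun k =>
    isBigO_const_const _ one_ne_zero _
  have hp : HasExpansion l d (fun z => k₀ + k₁ * d z + k₂ * d z ^ 2 + k₃ * d z ^ 3)
      (fun _ => k₀) (fun _ => k₁) (fun _ => k₂) (fun _ => k₃) :=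
    ⟨hb _, hb _, hb _, hb _, by simpa using isBigO_zero _ _⟩
  refine ⟨hb _, hb _, hb _, hb _, ?_⟩
  have h1 := (hf.mul hd hp).approx
  simp only [h₀, h₁, h₂, h₃] at h1
  have h2 : (fun z => -(1 / f z)) =O[l] fun _ => (1 : ℝ) := by
    refine IsBigO.of_bound (1 / m) (hlow.mono fun z hz => ?_)
    rw [norm_neg, norm_one, mul_one, Real.norm_eq_abs, abs_of_pos (one_div_pos.2 (hm.trans_le hz))]
    exact one_div_le_one_div_of_le hm hz
  have h3 := h2.mul h1
  simp only [one_mul] at h3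
  refine h3.congr' (hlow.mono fun z hz => ?_) EventuallyEq.rfl
  have : f z ≠ 0 := (hm.trans_le hz).ne'
  field_simp
  ring

/-- Substituting an expansion without constant term into an expansion at `0`. -/
theorem comp (hd : d =O[l] fun _ => (1 : ℝ)) (hd0 : Tendsto d l (𝓝 0)) {F : ℝ → ℝ}
    {k₀ k₁ k₂ k₃ : ℝ}
    (hF : HasExpansion (𝓝[≥] 0) (fun x => x) F (fun _ => k₀) (fun _ => k₁) (fun _ => k₂)
      (fun _ => k₃))
    (hf : HasExpansion l d f (fun _ => 0) a₁ a₂ a₃) (hpos : ∀ᶠ z in l, 0 ≤ f z) :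
    HasExpansion l d (fun z => F (f z)) (fun _ => k₀) (fun z => k₁ * a₁ z)
      (fun z => k₁ * a₂ z + k₂ * a₁ z ^ 2)
      (fun z => k₁ * a₃ z + 2 * k₂ * a₁ z * a₂ z + k₃ * a₁ z ^ 3) := by
  -- With no constant term `f = O(d)`, so the remainder `O(f⁴)` of the outer expansion is `O(d⁴)`.
  have hO : f =O[l] d := by
    have h2 : (fun z => d z ^ 2) =O[l] fun _ => (1 : ℝ) := by simpa using hd.pow 2
    have h3 : (fun z => d z ^ 3) =O[l] fun _ => (1 : ℝ) := by simpa using hd.pow 3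
    have e1 := ((hf.bdd₁.add (isBigO_one_mul hf.bdd₂ hd)).add (isBigO_one_mul hf.bdd₃ h2)).mul
      (isBigO_refl d l)
    have e2 := hf.approx.trans (h3.mul (isBigO_refl d l) |>.congr_left fun z => by
      rw [← pow_succ])
    simp only [one_mul] at e1 e2
    exact (e1.add e2).congr_left fun z => by ring
  have ht : Tendsto f l (𝓝[≥] 0) :=
    tendsto_nhdsWithin_iff.2 ⟨hO.trans_tendsto hd0, hpos⟩
  have h1 := (hF.approx.comp_tendsto ht).trans (hO.pow 4)
  have hsq := hf.mul hd hf
  have hcu := hsq.mul hd hf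
  have hpoly := ((const (l := l) (d := d) k₀).add (hf.const_mul hd k₁)).add
    ((hsq.const_mul hd k₂).add (hcu.const_mul hd k₃))
  have h2 := (hpoly.congr_coeff (b₀ := fun _ => k₀) (b₁ := fun z => k₁ * a₁ z)
      (b₂ := fun z => k₁ * a₂ z + k₂ * a₁ z ^ 2)
      (b₃ := fun z => k₁ * a₃ z + 2 * k₂ * a₁ z * a₂ z + k₃ * a₁ z ^ 3)
    (fun z => by ring) (fun z => by ring) (fun z => by ring) (fun z => by ring))
  refine ⟨h2.bdd₀, h2.bdd₁, h2.bdd₂, h2.bdd₃, (h1.add h2.approx).congr_left fun z => ?_⟩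
  simp only [Function.comp_apply]
  ring

end HasExpansion

/-- A cubic polynomial that is `O(δ^(n+1))` has vanishing constant coefficient. -/
theorem eq_zero_of_eventually_le {m₀ m₁ m₂ m₃ K : ℝ} (n : ℕ)
    (h : ∀ᶠ x : ℝ in 𝓝[>] 0, |m₀ + m₁ * x + m₂ * x ^ 2 + m₃ * x ^ 3| ≤ K * x ^ (n + 1)) :
    m₀ = 0 := by
  have h1 : Tendsto (fun x : ℝ => |m₀ + m₁ * x + m₂ * x ^ 2 + m₃ * x ^ 3|) (𝓝[>] 0) (𝓝 |m₀|) := by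
    have : Continuous fun x : ℝ => |m₀ + m₁ * x + m₂ * x ^ 2 + m₃ * x ^ 3| := by fun_prop
    simpa using (this.tendsto 0).mono_left nhdsWithin_le_nhds
  have h2 : Tendsto (fun x : ℝ => K * x ^ (n + 1)) (𝓝[>] 0) (𝓝 0) := by
    have : Continuous fun x : ℝ => K * x ^ (n + 1) := by fun_prop
    simpa using (this.tendsto 0).mono_left nhdsWithin_le_nhds
  exact abs_eq_zero.1 (le_antisymm (le_of_tendsto_of_tendsto h1 h2 h) (abs_nonneg _))

/-- Once the constant term is known to vanish, dividing by `x` shifts the coefficients and lowers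
the power on the right by one; four rounds suffice. -/
theorem coeffs_eq_zero_of_eventually_le {m₀ m₁ m₂ m₃ K : ℝ}
    (h : ∀ᶠ x : ℝ in 𝓝[>] 0, |m₀ + m₁ * x + m₂ * x ^ 2 + m₃ * x ^ 3| ≤ K * x ^ 4) :
    m₀ = 0 ∧ m₁ = 0 ∧ m₂ = 0 ∧ m₃ = 0 := by
  have shift : ∀ {m₁ m₂ m₃ : ℝ} (n : ℕ),
      (∀ᶠ x : ℝ in 𝓝[>] 0, |0 + m₁ * x + m₂ * x ^ 2 + m₃ * x ^ 3| ≤ K * x ^ (n + 1)) →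
      ∀ᶠ x : ℝ in 𝓝[>] 0, |m₁ + m₂ * x + m₃ * x ^ 2 + 0 * x ^ 3| ≤ K * x ^ n := by
    intro m₁ m₂ m₃ n h
    filter_upwards [h, self_mem_nhdsWithin] with x hx hx0
    have hx0 : 0 < x := hx0
    rw [show 0 + m₁ * x + m₂ * x ^ 2 + m₃ * x ^ 3 = x * (m₁ + m₂ * x + m₃ * x ^ 2 + 0 * x ^ 3) by
      ring, abs_mul, abs_of_pos hx0, pow_succ' x n] at hx
    exact le_of_mul_le_mul_left (by linarith) hx0
  obtain rfl := eq_zero_of_eventually_le 3 h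
  have h := shift 3 h
  obtain rfl := eq_zero_of_eventually_le 2 h
  have h := shift 2 h
  obtain rfl := eq_zero_of_eventually_le 1 h
  have h := shift 1 h
  exact ⟨rfl, rfl, rfl, eq_zero_of_eventually_le 0 h⟩

/-- If the parameter integrals of a uniformly expandable function vanish, so do the integrals of
its coefficients. -/
theorem HasExpansion.integral_coeff_eq_zero {F : ℝ × ℝ → ℝ} {c₀ c₁ c₂ c₃ : ℝ → ℝ} {a b : ℝ}
    (h : HasExpansion (𝓝[>] (0 : ℝ) ×ˢ ⊤) Prod.fst F (fun z => c₀ z.2) (fun z => c₁ z.2)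
      (fun z => c₂ z.2) (fun z => c₃ z.2))
    (h₀ : Continuous c₀) (h₁ : Continuous c₁) (h₂ : Continuous c₂) (h₃ : Continuous c₃)
    (hF : ∀ᶠ x in 𝓝[>] (0 : ℝ), IntervalIntegrable (fun φ => F (x, φ)) volume a b)
    (hI : ∀ᶠ x in 𝓝[>] (0 : ℝ), ∫ φ in a..b, F (x, φ) = 0) :
    ∫ φ in a..b, c₀ φ = 0 ∧ ∫ φ in a..b, c₁ φ = 0 ∧ ∫ φ in a..b, c₂ φ = 0 ∧
      ∫ φ in a..b, c₃ φ = 0 := by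
  obtain ⟨K, hK⟩ := h.approx.bound
  -- The factor `⊤` in the filter makes the bound hold for every `φ` at once, so it survives
  -- integration.
  have hK' : ∀ᶠ x in 𝓝[>] (0 : ℝ), ∀ φ : ℝ,
      ‖F (x, φ) - (c₀ φ + c₁ φ * x + c₂ φ * x ^ 2 + c₃ φ * x ^ 3)‖ ≤ K * ‖x ^ 4‖ := by
    obtain ⟨pa, hpa, pb, hpb, hp⟩ := eventually_prod_iff.1 hK
    rw [eventually_top] at hpb
    exact hpa.mono fun x hx φ => hp hx (hpb φ)
  refine coeffs_eq_zero_of_eventually_le (K := K * |b - a|) ?_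
  filter_upwards [hK', hF, hI] with x hx hFx hIx
  have hc : Continuous fun φ => c₀ φ + c₁ φ * x + c₂ φ * x ^ 2 + c₃ φ * x ^ 3 := by fun_prop
  have e1 : ∫ φ in a..b, (F (x, φ) - (c₀ φ + c₁ φ * x + c₂ φ * x ^ 2 + c₃ φ * x ^ 3))
      = -((∫ φ in a..b, c₀ φ) + (∫ φ in a..b, c₁ φ) * x + (∫ φ in a..b, c₂ φ) * x ^ 2
        + (∫ φ in a..b, c₃ φ) * x ^ 3) := by
    rw [intervalIntegral.integral_sub hFx (hc.intervalIntegrable _ _), hIx,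
      intervalIntegral.integral_add, intervalIntegral.integral_add, intervalIntegral.integral_add]
    · simp only [intervalIntegral.integral_mul_const, zero_sub]
    all_goals exact Continuous.intervalIntegrable (by fun_prop) _ _
  have e2 := intervalIntegral.norm_integral_le_of_norm_le_const (a := a) (b := b)
    (f := fun φ => F (x, φ) - (c₀ φ + c₁ φ * x + c₂ φ * x ^ 2 + c₃ φ * x ^ 3))
    (fun φ _ => hx φ)
  rw [e1, norm_neg, Real.norm_eq_abs, Real.norm_of_nonneg (by positivity)] at e2
  linarith

/-! ### Expansions of the one-variable factors at zero -/

theorem isBigO_id_one : (fun x : ℝ => x) =O[𝓝[≥] 0] fun _ => (1 : ℝ) :=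
  ((continuous_id.tendsto 0).mono_left nhdsWithin_le_nhds).isBigO_one ℝ

theorem eventually_mem_Icc {e : ℝ} (he : 0 < e) : ∀ᶠ x : ℝ in 𝓝[≥] 0, x ∈ Icc 0 e := by
  filter_upwards [self_mem_nhdsWithin, nhdsWithin_le_nhds (Iic_mem_nhds he)] with x h1 h2
  exact ⟨h1, h2⟩

/-- The neighbourhood is one-sided but contains `0`: the arguments substituted later are nonnegative
and vanish where `cos φ` or `sin φ` does. -/
theorem hasExpansion_of_bound {f : ℝ → ℝ} {k₀ k₁ k₂ k₃ K e : ℝ} (he : 0 < e)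
    (h : ∀ x, 0 ≤ x → x ≤ e →
      |f x - (k₀ + k₁ * x + k₂ * x ^ 2 + k₃ * x ^ 3)| ≤ K * x ^ 4) :
    HasExpansion (𝓝[≥] 0) (fun x => x) f (fun _ => k₀) (fun _ => k₁) (fun _ => k₂)
      (fun _ => k₃) := by
  have hb : ∀ k : ℝ, (fun _ : ℝ => k) =O[𝓝[≥] 0] fun _ => (1 : ℝ) := fun k =>
    isBigO_const_const _ one_ne_zero _
  refine ⟨hb _, hb _, hb _, hb _, IsBigO.of_bound K ?_⟩
  filter_upwards [eventually_mem_Icc he] with x hx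
  rw [Real.norm_eq_abs, Real.norm_of_nonneg (by positivity)]
  exact h x hx.1 hx.2

theorem hasExpansion_trisect : HasExpansion (𝓝[≥] 0) (fun x => x) trisect (fun _ => 0)
    (fun _ => 1 / 9) (fun _ => 8 / 243) (fun _ => 112 / 6561) := by
  refine hasExpansion_of_bound (K := 1) (e := 1 / 10) (by norm_num) fun x h0 h1 => ?_
  have ha0 := trisect_nonneg x
  have hq := trisect_le (x := x)
  have he := trisect_eq h0 (by linarith)
  set a := trisect x
  have ha1 : a ≤ x / 4 := by
    have : 4 ≤ (3 - 4 * a) ^ 2 := by nlinarith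
    nlinarith
  -- `P` is the truncated series inverse of `a ↦ a (3 - 4a)²`. The error `a - P` is the residual of
  -- `P` divided by a difference quotient that is at least 1 near zero.
  set P := 0 + 1 / 9 * x + 8 / 243 * x ^ 2 + 112 / 6561 * x ^ 3 with hP
  have hx2 : x ^ 2 ≤ x / 10 := by nlinarith
  have hx3 : x ^ 3 ≤ x / 100 := by nlinarith [mul_nonneg h0 h0]
  have hP0 : 0 ≤ P := by positivity
  have hP1 : P ≤ x / 4 := by rw [hP]; linarith
  have e1 : (a - P) * (9 - 24 * (a + P) + 16 * (a ^ 2 + a * P + P ^ 2))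
      = x - P * (3 - 4 * P) ^ 2 := by rw [← he]; ring
  have hfac : 1 ≤ 9 - 24 * (a + P) + 16 * (a ^ 2 + a * P + P ^ 2) := by
    have : 0 ≤ 16 * (a ^ 2 + a * P + P ^ 2) := by positivity
    linarith
  obtain ⟨R, hR, hRb⟩ : ∃ R, x - P * (3 - 4 * P) ^ 2 = x ^ 4 * R ∧ |R| ≤ 1 := by
    refine ⟨(640 / 6561) + (5888 / 531441) * x + (2048 / 4782969) * x ^ 2 + (-315392 / 129140163) * x ^ 3 + (-1605632 / 3486784401) * x ^ 4 + (-22478848 / 282429536481) * x ^ 5, by rw [hP]; ring, ?_⟩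
    have p1 : x ^ 4 ≤ 1 := pow_le_one₀ h0 (by linarith)
    have p2 : x ^ 5 ≤ 1 := pow_le_one₀ h0 (by linarith)
    have p3 : x ^ 2 ≤ 1 := by linarith
    have p4 : x ^ 3 ≤ 1 := by linarith
    have q1 := pow_nonneg h0 2
    have q2 := pow_nonneg h0 3
    have q3 := pow_nonneg h0 4
    have q4 := pow_nonneg h0 5
    rw [abs_le]
    constructor <;> linarith
  have e2 : |a - P| * 1 ≤ |a - P| * (9 - 24 * (a + P) + 16 * (a ^ 2 + a * P + P ^ 2)) :=
    mul_le_mul_of_nonneg_left hfac (abs_nonneg _)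
  rw [← abs_of_nonneg (zero_le_one.trans hfac), ← abs_mul,
    e1, hR, abs_mul, abs_of_nonneg (by positivity : 0 ≤ x ^ 4)] at e2
  have := mul_le_mul_of_nonneg_left hRb (by positivity : 0 ≤ x ^ 4)
  linarith

theorem hasExpansion_inv_sqrt : HasExpansion (𝓝[≥] 0) (fun x => x) (fun x => 1 / √(1 - x))
    (fun _ => 1) (fun _ => 1 / 2) (fun _ => 3 / 8) (fun _ => 5 / 16) := by
  refine hasExpansion_of_bound (K := 2) (e := 1 / 10) (by norm_num) fun x h0 h1 => ?_
  have hs : 0 < √(1 - x) := sqrt_pos.2 (by linarith)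
  have hsq : (1 / √(1 - x)) ^ 2 * (1 - x) = 1 := by
    rw [div_pow, one_pow, sq_sqrt (by linarith)]
    exact one_div_mul_cancel (by linarith)
  have hpos : 0 < 1 / √(1 - x) := one_div_pos.2 hs
  set s := 1 / √(1 - x)
  set P := 1 + 1 / 2 * x + 3 / 8 * x ^ 2 + 5 / 16 * x ^ 3 with hP
  have hP1 : 1 ≤ P := by
    have : 0 ≤ 1 / 2 * x + 3 / 8 * x ^ 2 + 5 / 16 * x ^ 3 := by positivity
    rw [hP]; linarith
  -- Same scheme as for `trisect`, with `s² (1 - x) = 1` as defining equation and the binomial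
  -- series as `P`.
  have e1 : (s - P) * ((s + P) * (1 - x)) = 1 - (1 - x) * P ^ 2 := by
    linear_combination hsq
  have hfac : 9 / 10 ≤ (s + P) * (1 - x) := by
    nlinarith [mul_nonneg (show 0 ≤ s + P - 1 by linarith) (show 0 ≤ 1 - x by linarith)]
  obtain ⟨R, hR, hRb⟩ : ∃ R, 1 - (1 - x) * P ^ 2 = x ^ 4 * R ∧ |R| ≤ 1 := by
    refine ⟨(35 / 64) + (7 / 32) * x + (35 / 256) * x ^ 2 + (25 / 256) * x ^ 3, by rw [hP]; ring, ?_⟩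
    have p1 : x ^ 2 ≤ x := by nlinarith
    have p2 : x ^ 3 ≤ x := by nlinarith
    have q1 := pow_nonneg h0 2
    have q2 := pow_nonneg h0 3
    rw [abs_le]
    constructor <;> linarith
  have e2 : |s - P| * (9 / 10) ≤ |s - P| * ((s + P) * (1 - x)) :=
    mul_le_mul_of_nonneg_left hfac (abs_nonneg _)
  have hf0 : 0 ≤ (s + P) * (1 - x) := by linarith
  rw [← abs_of_nonneg hf0, ← abs_mul,
    e1, hR, abs_mul, abs_of_nonneg (by positivity : 0 ≤ x ^ 4)] at e2
  have := mul_le_mul_of_nonneg_left hRb (by positivity : 0 ≤ x ^ 4)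
  linarith [abs_nonneg (s - P), pow_nonneg h0 4]

/-- The `x`-factors of the kernel. -/
noncomputable def radial₀ (x : ℝ) : ℝ :=
  1 / (3 + -4 * trisect x) * (1 / √(1 - x) * (1 / √(1 - x) * (1 / √(1 - x))))

noncomputable def radial₁ (x : ℝ) : ℝ :=
  radial₀ x * (trisect x * (5 + -4 * trisect x))

/-- The `y`-factors of the kernel. -/
noncomputable def angular₀ (y : ℝ) : ℝ := (1 + -2 * trisect y) * (1 / √(1 - y))

noncomputable def angular₁ (y : ℝ) : ℝ :=
  2 * (trisect y * (3 + -4 * trisect y)) * (1 / √(1 - y))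

noncomputable def angular₂ (y : ℝ) : ℝ := angular₁ y * (1 / (1 + -4 * trisect y))

/-- Separation of variables lets each factor be expanded on its own. The factors use forms such as
`3 + -4 * a` so that they match `HasExpansion.add` and `HasExpansion.const_mul` syntactically. -/
theorem kernel_eq (b₀ b₁ b₂ b₃ x y : ℝ) : kernel b₀ b₁ b₂ b₃ x y =
    b₀ * (radial₀ x * angular₀ y) + b₁ * (radial₁ x * angular₀ y)
      + (b₂ * (radial₀ x * angular₁ y) + b₃ * (radial₁ x * angular₂ y)) := by
  simp only [kernel, radial₀, radial₁, angular₀, angular₁, angular₂, mul_inv,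
    div_eq_mul_inv, neg_mul, ← sub_eq_add_neg]
  ring

theorem hasExpansion_radial₀ : HasExpansion (𝓝[≥] 0) (fun x => x) radial₀ (fun _ => 1 / 3)
    (fun _ => 89 / 162) (fun _ => 4205 / 5832) (fun _ => 273259 / 314928) := by
  have hd := isBigO_id_one
  have h1 := ((HasExpansion.const 3).add (hasExpansion_trisect.const_mul hd (-4))).inv hd
    (m := 2) (by norm_num)
    (Eventually.of_forall fun x => by linarith [trisect_le (x := x)])
    (1 / 3) (4 / 81) (16 / 729) (256 / 19683) (fun _ => by norm_num) (fun _ => by norm_num)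
    (fun _ => by norm_num) (fun _ => by norm_num)
  have h2 := h1.mul hd (hasExpansion_inv_sqrt.mul hd
    (hasExpansion_inv_sqrt.mul hd hasExpansion_inv_sqrt))
  exact h2.congr_coeff (fun _ => by norm_num) (fun _ => by norm_num) (fun _ => by norm_num)
    (fun _ => by norm_num)

theorem hasExpansion_radial₁ : HasExpansion (𝓝[≥] 0) (fun x => x) radial₁ (fun _ => 0)
    (fun _ => 5 / 27) (fun _ => 167 / 486) (fun _ => 8443 / 17496) := by
  have hd := isBigO_id_one
  have h1 := hasExpansion_trisect.mul hd
    ((HasExpansion.const 5).add (hasExpansion_trisect.const_mul hd (-4)))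
  exact (hasExpansion_radial₀.mul hd h1).congr_coeff (fun _ => by norm_num)
    (fun _ => by norm_num) (fun _ => by norm_num) (fun _ => by norm_num)

theorem hasExpansion_angular₀ : HasExpansion (𝓝[≥] 0) (fun x => x) angular₀ (fun _ => 1)
    (fun _ => 5 / 18) (fun _ => 385 / 1944) (fun _ => 17017 / 104976) := by
  have hd := isBigO_id_one
  have h1 := (HasExpansion.const 1).add (hasExpansion_trisect.const_mul hd (-2))
  exact (h1.mul hd hasExpansion_inv_sqrt).congr_coeff (fun _ => by norm_num)
    (fun _ => by norm_num) (fun _ => by norm_num) (fun _ => by norm_num)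

theorem hasExpansion_angular₁ : HasExpansion (𝓝[≥] 0) (fun x => x) angular₁ (fun _ => 0)
    (fun _ => 2 / 3) (fun _ => 35 / 81) (fun _ => 1001 / 2916) := by
  have hd := isBigO_id_one
  have h1 := (hasExpansion_trisect.mul hd
    ((HasExpansion.const 3).add (hasExpansion_trisect.const_mul hd (-4)))).const_mul hd 2
  exact (h1.mul hd hasExpansion_inv_sqrt).congr_coeff (fun _ => by norm_num)
    (fun _ => by norm_num) (fun _ => by norm_num) (fun _ => by norm_num)

theorem hasExpansion_angular₂ : HasExpansion (𝓝[≥] 0) (fun x => x) angular₂ (fun _ => 0)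
    (fun _ => 2 / 3) (fun _ => 59 / 81) (fun _ => 2201 / 2916) := by
  have hd := isBigO_id_one
  have hlow : ∀ᶠ x : ℝ in 𝓝[≥] 0, 1 / 2 ≤ 1 + -4 * trisect x := by
    filter_upwards [eventually_mem_Icc (by norm_num : (0 : ℝ) < 1 / 2)] with x hx
    have h := trisect_eq hx.1 (by linarith [hx.2])
    have h1 := trisect_le (x := x)
    have h0 := trisect_nonneg x
    have : 4 ≤ (3 - 4 * trisect x) ^ 2 := by nlinarith
    nlinarith [hx.2]
  have h1 := ((HasExpansion.const 1).add (hasExpansion_trisect.const_mul hd (-4))).inv hd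
    (m := 1 / 2) (by norm_num) hlow
    1 (4 / 9) (80 / 243) (1792 / 6561) (fun _ => by norm_num) (fun _ => by norm_num)
    (fun _ => by norm_num) (fun _ => by norm_num)
  exact (hasExpansion_angular₁.mul hd h1).congr_coeff (fun _ => by norm_num)
    (fun _ => by norm_num) (fun _ => by norm_num) (fun _ => by norm_num)

/-! ### Expansion of the kernel, uniform in the angle -/

/-- The filter of small parameters, uniformly in the angle. -/
def smallParam : Filter (ℝ × ℝ) := 𝓝[>] (0 : ℝ) ×ˢ ⊤

theorem tendsto_fst_smallParam : Tendsto Prod.fst smallParam (𝓝 0) :=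
  tendsto_fst.mono_right nhdsWithin_le_nhds

theorem isBigO_fst_smallParam : Prod.fst =O[smallParam] fun _ => (1 : ℝ) :=
  tendsto_fst_smallParam.isBigO_one ℝ

theorem eventually_smallParam {e : ℝ} (he : 0 < e) :
    ∀ᶠ z : ℝ × ℝ in smallParam, 0 < z.1 ∧ z.1 < e := by
  have : ∀ᶠ x : ℝ in 𝓝[>] 0, 0 < x ∧ x < e := Ioo_mem_nhdsGT he
  exact tendsto_fst.eventually this

theorem isBigO_trig {f : ℝ → ℝ} (hf : ∀ φ, |f φ| ≤ 1) :
    (fun z : ℝ × ℝ => f z.2) =O[smallParam] fun _ => (1 : ℝ) :=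
  IsBigO.of_bound 1 (Eventually.of_forall fun z => by simpa using hf z.2)

theorem abs_cos_sq_le (φ : ℝ) : |cos φ ^ 2| ≤ 1 := by
  rw [abs_of_nonneg (sq_nonneg _)]; exact cos_sq_le_one φ

theorem abs_sin_sq_le (φ : ℝ) : |sin φ ^ 2| ≤ 1 := by
  rw [abs_of_nonneg (sq_nonneg _)]; exact sin_sq_le_one φ

section
variable {F : ℝ → ℝ} {k₀ k₁ k₂ k₃ : ℝ}

theorem HasExpansion.comp_cos
    (hF : HasExpansion (𝓝[≥] 0) (fun x => x) F (fun _ => k₀) (fun _ => k₁) (fun _ => k₂)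
      (fun _ => k₃)) :
    HasExpansion smallParam Prod.fst (fun z => F (z.1 * cos z.2 ^ 2)) (fun _ => k₀)
      (fun z => k₁ * cos z.2 ^ 2) (fun z => k₂ * (cos z.2 ^ 2) ^ 2)
      (fun z => k₃ * (cos z.2 ^ 2) ^ 3) := by
  have h1 := HasExpansion.id.mul isBigO_fst_smallParam
    (HasExpansion.of_bdd (isBigO_trig abs_cos_sq_le))
  have h2 := (h1.congr_coeff (b₀ := fun _ => 0) (b₁ := fun z => cos z.2 ^ 2) (b₂ := fun _ => 0)
    (b₃ := fun _ => 0) (fun _ => by ring) (fun _ => by ring) (fun _ => by ring)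
    (fun _ => by ring))
  refine (HasExpansion.comp isBigO_fst_smallParam tendsto_fst_smallParam hF h2
    ((eventually_smallParam one_pos).mono fun z hz => mul_nonneg hz.1.le (sq_nonneg _))).congr_coeff
    (fun _ => rfl) (fun _ => by ring) (fun _ => by ring) (fun _ => by ring)

/-- The inner argument is `t sin² φ (δ + δ² + δ³ + ⋯)`, the geometric series of `δ/(1-δ)`; it is `(r
sin φ)²` when `t = 1/(κ-1)`. -/
theorem HasExpansion.comp_sin {t : ℝ} (ht : 0 < t)
    (hF : HasExpansion (𝓝[≥] 0) (fun x => x) F (fun _ => k₀) (fun _ => k₁) (fun _ => k₂)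
      (fun _ => k₃)) :
    HasExpansion smallParam Prod.fst
      (fun z => F (t * (z.1 * (1 / (1 + -1 * z.1)) * sin z.2 ^ 2))) (fun _ => k₀)
      (fun z => k₁ * t * sin z.2 ^ 2)
      (fun z => k₁ * t * sin z.2 ^ 2 + k₂ * t ^ 2 * (sin z.2 ^ 2) ^ 2)
      (fun z => k₁ * t * sin z.2 ^ 2 + 2 * k₂ * t ^ 2 * (sin z.2 ^ 2) ^ 2
        + k₃ * t ^ 3 * (sin z.2 ^ 2) ^ 3) := by
  have hd := isBigO_fst_smallParam
  have hs := eventually_smallParam (e := 1 / 2) (by norm_num)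
  have h0 := ((HasExpansion.const 1).add (HasExpansion.id.const_mul hd (-1))).inv hd
    (m := 1 / 2) (by norm_num) (hs.mono fun z hz => by linarith [hz.2])
    1 1 1 1 (fun _ => by norm_num) (fun _ => by norm_num)
    (fun _ => by norm_num) (fun _ => by norm_num)
  have h1 := ((HasExpansion.id.mul hd h0).mul hd
    (HasExpansion.of_bdd (isBigO_trig abs_sin_sq_le))).const_mul hd t
  have h2 := (h1.congr_coeff (b₀ := fun _ => 0) (b₁ := fun z => t * sin z.2 ^ 2)
    (b₂ := fun z => t * sin z.2 ^ 2) (b₃ := fun z => t * sin z.2 ^ 2) (fun _ => by ring)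
    (fun _ => by ring) (fun _ => by ring) (fun _ => by ring))
  refine (HasExpansion.comp hd tendsto_fst_smallParam hF h2
    (hs.mono fun z hz => ?_)).congr_coeff
    (fun _ => rfl) (fun _ => by ring) (fun _ => by ring) (fun _ => by ring)
  have : 0 < 1 + -1 * z.1 := by linarith [hz.2]
  have := hz.1
  positivity

end

/-! ### Integrated coefficients and the linear system -/

/-- A quartic polynomial in `sin² φ`. -/
noncomputable def quarticSin (e₀ e₁ e₂ e₃ e₄ φ : ℝ) : ℝ :=
  e₀ + e₁ * sin φ ^ 2 + e₂ * sin φ ^ 4 + e₃ * sin φ ^ 6 + e₄ * sin φ ^ 8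

theorem continuous_quarticSin (e₀ e₁ e₂ e₃ e₄ : ℝ) : Continuous (quarticSin e₀ e₁ e₂ e₃ e₄) := by
  unfold quarticSin; fun_prop

theorem integral_sin_pow_add_two (n : ℕ) :
    ∫ φ in (-(π / 2))..(π / 2), sin φ ^ (n + 2)
      = (n + 1) / (n + 2) * ∫ φ in (-(π / 2))..(π / 2), sin φ ^ n := by
  rw [integral_sin_pow]; simp

theorem integral_quarticSin (e₀ e₁ e₂ e₃ e₄ : ℝ) :
    ∫ φ in (-(π / 2))..(π / 2), quarticSin e₀ e₁ e₂ e₃ e₄ φ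
      = π * (e₀ + e₁ / 2 + 3 * e₂ / 8 + 5 * e₃ / 16 + 35 * e₄ / 128) := by
  have h0 : ∫ φ in (-(π / 2))..(π / 2), sin φ ^ 0 = π := by simp
  have h2 := integral_sin_pow_add_two 0
  have h4 := integral_sin_pow_add_two 2
  have h6 := integral_sin_pow_add_two 4
  have h8 := integral_sin_pow_add_two 6
  norm_num only at h2 h4 h6 h8
  rw [h0] at h2
  rw [h2] at h4
  rw [h4] at h6
  rw [h6] at h8
  unfold quarticSin
  rw [intervalIntegral.integral_add, intervalIntegral.integral_add, intervalIntegral.integral_add,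
    intervalIntegral.integral_add, intervalIntegral.integral_const]
  · simp only [intervalIntegral.integral_const_mul, h2, h4, h6, h8, smul_eq_mul]
    ring
  all_goals exact Continuous.intervalIntegrable (by fun_prop) _ _

/-- The coefficients are Cauchy products of the factor expansions, with `cos²` replaced by `1 -
sin²`. The outer `cos² φ` raises the degree in `sin² φ` at order three from three to four. -/
theorem hasExpansion_kernel {t : ℝ} (ht : 0 < t) (b₀ b₁ b₂ b₃ : ℝ) :
    HasExpansion smallParam Prod.fst
      (fun z => cos z.2 ^ 2 * kernel b₀ b₁ b₂ b₃ (z.1 * cos z.2 ^ 2)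
        (t * (z.1 * (1 / (1 + -1 * z.1)) * sin z.2 ^ 2)))
      (fun z => quarticSin (b₀ * (1 / 3)) (b₀ * (-1 / 3)) (0) (0) (0) z.2)
      (fun z => quarticSin (b₀ * (89 / 162) + b₁ * (5 / 27)) (b₀ * ((-89 / 81) + 5 / 54 * t) + b₁ * ((-10
      / 27)) + b₂ * (2 / 9 * t)) (b₀ * (89 / 162 + (-5 / 54) * t) + b₁ * (5 / 27) + b₂ * ((-2 /
      9) * t)) (0) (0) z.2)
      (fun z => quarticSin (b₀ * (4205 / 5832) + b₁ * (167 / 486)) (b₀ * ((-4205 / 1944) + 715 / 2916 * t)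
      + b₁ * ((-167 / 162) + 25 / 486 * t) + b₂ * (143 / 243 * t) + b₃ * (10 / 81 * t)) (b₀ *
      (4205 / 1944 + (-290 / 729) * t + 385 / 5832 * t ^ 2) + b₁ * (167 / 162 + (-25 / 243) * t)
      + b₂ * ((-232 / 243) * t + 35 / 243 * t ^ 2) + b₃ * ((-20 / 81) * t)) (b₀ * ((-4205 /
      5832) + 445 / 2916 * t + (-385 / 5832) * t ^ 2) + b₁ * ((-167 / 486) + 25 / 486 * t) + b₂
      * (89 / 243 * t + (-35 / 243) * t ^ 2) + b₃ * (10 / 81 * t)) (0) z.2)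
      (fun z => quarticSin (b₀ * (273259 / 314928) + b₁ * (8443 / 17496)) (b₀ * ((-273259 / 78732) + 46765
      / 104976 * t) + b₁ * ((-8443 / 4374) + 1285 / 8748 * t) + b₂ * (9353 / 8748 * t) + b₃ *
      (257 / 729 * t)) (b₀ * (273259 / 52488 + (-34945 / 34992) * t + 75845 / 314928 * t ^ 2) +
      b₁ * (8443 / 2916 + (-1135 / 2916) * t + 1925 / 52488 * t ^ 2) + b₂ * ((-6989 / 2916) * t
      + 6895 / 13122 * t ^ 2) + b₃ * ((-227 / 243) * t + 295 / 2187 * t ^ 2)) (b₀ * ((-273259 /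
      78732) + 26365 / 34992 * t + (-55055 / 157464) * t ^ 2 + 17017 / 314928 * t ^ 3) + b₁ *
      ((-8443 / 4374) + 985 / 2916 * t + (-1925 / 26244) * t ^ 2) + b₂ * (5273 / 2916 * t +
      (-5005 / 6561) * t ^ 2 + 1001 / 8748 * t ^ 3) + b₃ * (197 / 243 * t + (-590 / 2187) * t ^
      2)) (b₀ * (273259 / 314928 + (-21025 / 104976) * t + 34265 / 314928 * t ^ 2 + (-17017 /
      314928) * t ^ 3) + b₁ * (8443 / 17496 + (-835 / 8748) * t + 1925 / 52488 * t ^ 2) + b₂ *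
      ((-4205 / 8748) * t + 3115 / 13122 * t ^ 2 + (-1001 / 8748) * t ^ 3) + b₃ * ((-167 / 729)
      * t + 295 / 2187 * t ^ 2)) z.2) := by
  have hd := isBigO_fst_smallParam
  have r0 := hasExpansion_radial₀.comp_cos
  have r1 := hasExpansion_radial₁.comp_cos
  have s0 := hasExpansion_angular₀.comp_sin ht
  have s1 := hasExpansion_angular₁.comp_sin ht
  have s2 := hasExpansion_angular₂.comp_sin ht
  simp only [kernel_eq]
  refine ((HasExpansion.of_bdd (isBigO_trig abs_cos_sq_le)).mul hd
    ((((r0.mul hd s0).const_mul hd b₀).add ((r1.mul hd s0).const_mul hd b₁)).add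
      (((r0.mul hd s1).const_mul hd b₂).add ((r1.mul hd s2).const_mul hd b₃)))).congr_coeff
    (fun z => ?_) (fun z => ?_) (fun z => ?_) (fun z => ?_) <;>
  · simp only [quarticSin, cos_sq']
    ring

theorem continuous_trisect : Continuous trisect := by unfold trisect; fun_prop

theorem continuous_kernel {x y : ℝ → ℝ} (hx : Continuous x) (hy : Continuous y)
    (hx1 : ∀ φ, x φ < 1) (hy0 : ∀ φ, 0 ≤ y φ) (hy1 : ∀ φ, y φ < 1) (b₀ b₁ b₂ b₃ : ℝ) :
    Continuous fun φ => kernel b₀ b₁ b₂ b₃ (x φ) (y φ) := by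
  have ht := continuous_trisect
  have h1 : ∀ φ, (3 - 4 * trisect (x φ)) * √(1 - x φ) ^ 3 * √(1 - y φ) ≠ 0 := fun φ => by
    have e1 := trisect_le (x := x φ)
    have e2 : 0 < 3 - 4 * trisect (x φ) := by linarith
    have e3 : 0 < √(1 - x φ) := sqrt_pos.2 (by linarith [hx1 φ])
    have e4 : 0 < √(1 - y φ) := sqrt_pos.2 (by linarith [hy1 φ])
    positivity
  have h2 : ∀ φ, 1 - 4 * trisect (y φ) ≠ 0 := fun φ =>
    ne_of_gt (by linarith [trisect_lt (hy0 φ) (hy1 φ)])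
  unfold kernel
  fun_prop (disch := assumption)

/-- Successive orders in `x` determine `b₀ = 0`, then `b₁` and `b₃` in terms of `b₂`. The third
order leaves `t² (1 + t) b₂ = 0`, so positivity of `t` forces the trivial solution. -/
theorem coeffs_eq_zero {t b₀ b₁ b₂ b₃ : ℝ} (ht : 0 < t)
    (h : ∀ᶠ x in 𝓝[>] (0 : ℝ), ∫ φ in (-(π / 2))..(π / 2),
      cos φ ^ 2 * kernel b₀ b₁ b₂ b₃ (x * cos φ ^ 2)
        (t * (x * (1 / (1 + -1 * x)) * sin φ ^ 2)) = 0) :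
    b₀ = 0 ∧ b₁ = 0 ∧ b₂ = 0 ∧ b₃ = 0 := by
  have hint : ∀ᶠ x in 𝓝[>] (0 : ℝ), IntervalIntegrable (fun φ =>
      cos φ ^ 2 * kernel b₀ b₁ b₂ b₃ (x * cos φ ^ 2)
        (t * (x * (1 / (1 + -1 * x)) * sin φ ^ 2))) volume (-(π / 2)) (π / 2) := by
    -- These bounds give `t x/(1-x) < 2 t x < 1`, keeping both arguments of the kernel below 1,
    -- where it is continuous.
    have hpos : 0 < min (1 / 2) (1 / (2 * t)) := by positivity
    filter_upwards [Ioo_mem_nhdsGT hpos] with x hx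
    have hx0 := hx.1
    have hx1 := hx.2.trans_le (min_le_left _ _)
    have hx2 := hx.2.trans_le (min_le_right _ _)
    rw [lt_div_iff₀ (by positivity)] at hx2
    have e1 : 0 < 1 / (1 + -1 * x) := one_div_pos.2 (by linarith)
    have e2 : 1 / (1 + -1 * x) < 2 := by
      rw [div_lt_iff₀ (by linarith)]; linarith
    have e3 : t * (x * (1 / (1 + -1 * x))) < 1 := by
      have := mul_lt_mul_of_pos_left e2 (mul_pos ht hx0)
      linarith
    have e4 : 0 < t * (x * (1 / (1 + -1 * x))) := by positivity
    refine ((continuous_cos.pow 2).mul (continuous_kernel (by fun_prop) (by fun_prop)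
      (fun φ => ?_) (fun φ => by positivity) (fun φ => ?_) b₀ b₁ b₂ b₃)).intervalIntegrable _ _
    · nlinarith [cos_sq_le_one φ]
    · nlinarith [sin_sq_le_one φ]
  obtain ⟨h0, h1, h2, h3⟩ := (hasExpansion_kernel ht b₀ b₁ b₂ b₃).integral_coeff_eq_zero
    (continuous_quarticSin _ _ _ _ _) (continuous_quarticSin _ _ _ _ _)
    (continuous_quarticSin _ _ _ _ _) (continuous_quarticSin _ _ _ _ _) hint h
  rw [integral_quarticSin, mul_eq_zero, or_iff_right pi_ne_zero] at h0 h1 h2 h3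
  obtain rfl : b₀ = 0 := by linarith
  have ht' : t ≠ 0 := ht.ne'
  obtain rfl : b₁ = -(2 / 5) * t * b₂ := by linear_combination 72 / 5 * h1
  obtain rfl : b₃ = -(1 + t) * b₂ :=
    mul_left_cancel₀ ht' (by linear_combination 648 / 5 * h2)
  have e : t ^ 2 * (1 + t) * b₂ = 0 := by linear_combination 5184 / 5 * h3
  have hne : t ^ 2 * (1 + t) ≠ 0 := by positivity
  obtain rfl := (mul_eq_zero.1 e).resolve_left hne
  simp

/-- Only the trivial combination vanishes identically near the center. -/
theorem params_eq_zero {κ : ℝ} (hκ : 1 < κ) {μ₁ μ₂ μ₃ μ₄ : ℝ}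
    (h : ∀ s ∈ Ioo 1 κ, genS κ μ₁ μ₂ μ₃ μ₄ s = 0) :
    μ₁ = 0 ∧ μ₂ = 0 ∧ μ₃ = 0 ∧ μ₄ = 0 := by
  have hq : 0 < κ - 1 := by linarith
  have hκ0 : 0 < κ := by linarith
  obtain ⟨h0, h1, h2, h3⟩ := coeffs_eq_zero (t := 1 / (κ - 1)) (b₀ := -(2 / 3) * μ₁ + μ₂ + μ₃
    - 2 * (κ - 1) * μ₄) (b₁ := 2 / 3 * μ₁ + 2 * κ * μ₄) (b₂ := (κ - 1) * μ₄ - μ₂ / 2)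
    (b₃ := 2 * κ * μ₄) (by positivity) (by
      have hpos : 0 < 1 - 1 / κ := by rw [sub_pos, div_lt_one hκ0]; exact hκ
      filter_upwards [Ioo_mem_nhdsGT hpos] with x hx
      obtain ⟨hx0, hx1⟩ := hx
      have hxκ : 1 < κ * (1 - x) := by
        rw [lt_sub_iff_add_lt, ← lt_sub_iff_add_lt', div_lt_iff₀ hκ0] at hx1
        linarith
      have hx1' : 0 < 1 - x := by
        by_contra h'
        nlinarith
      set r := √(1 / (κ - 1) * (x * (1 / (1 + -1 * x)))) with hr
      have hrx : 0 < 1 / (κ - 1) * (x * (1 / (1 + -1 * x))) := by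
        have : 0 < 1 + -1 * x := by linarith
        positivity
      have hr0 : 0 < r := sqrt_pos.2 hrx
      have hrsq : r ^ 2 = 1 / (κ - 1) * (x * (1 / (1 + -1 * x))) := sq_sqrt hrx.le
      have hr1 : (κ - 1) * r ^ 2 * (1 - x) = 1 - (1 - x) := by
        rw [hrsq, show 1 + -1 * x = 1 - x by ring]; field_simp; ring
      have hrlt : r < 1 := by
        by_contra h'
        have : 1 ≤ r ^ 2 := by nlinarith
        nlinarith [mul_le_mul_of_nonneg_left this (mul_pos hq hx1').le]
      -- The point `s = κ(1-x)` has `d = 1 - x`, so small `x > 0` means close to the center.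
      have hs := h (κ * (1 - x)) ⟨hxκ, by nlinarith⟩
      rw [genS, hOf, mul_div_cancel_left₀ _ hκ0.ne', genH_eq_kernel hκ hx1' (by linarith) hxκ hr0
        hrlt hr1, mul_eq_zero] at hs
      have hne : 2 * √(1 - x) ^ 3 * √(1 - (1 - x)) * r ≠ 0 := by
        have := sqrt_pos.2 hx1'
        have : 0 < √(1 - (1 - x)) := sqrt_pos.2 (by linarith)
        positivity
      have hs := hs.resolve_left hne
      rw [← hs]
      simp only [sub_sub_cancel, mul_pow, hrsq, mul_assoc])
  -- The passage from the `μᵢ` to the `bᵢ` is triangular: `b₃` gives `μ₄`, then `b₁`, `b₂` and `b₀`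
  -- give `μ₁`, `μ₂` and `μ₃`.
  have e4 : μ₄ = 0 := by
    rcases mul_eq_zero.1 h3 with h | h
    · linarith
    · exact h
  subst e4
  refine ⟨by linarith, by linarith, by linarith, rfl⟩

/-! ### Prescribing three zeros by linear algebra -/

theorem genS_linear (κ s : ℝ) : ∃ a b c d : ℝ, ∀ μ₁ μ₂ μ₃ μ₄ : ℝ,
    genS κ μ₁ μ₂ μ₃ μ₄ s = μ₁ * a + μ₂ * b + μ₃ * c + μ₄ * d :=
  ⟨_, _, _, _, fun _ _ _ _ => by rw [genS, genH, mul_assoc]⟩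

/-- Three linear equations in four unknowns have a nontrivial solution. -/
theorem exists_nontrivial_solution (A : Fin 3 → Fin 4 → ℝ) :
    ∃ v : Fin 4 → ℝ, v ≠ 0 ∧ ∀ i, ∑ j, v j * A i j = 0 := by
  have hker : LinearMap.ker (Matrix.mulVecLin (Matrix.of A)) ≠ ⊥ :=
    LinearMap.ker_ne_bot_of_finrank_lt (by simp)
  obtain ⟨v, hv, hv0⟩ := Submodule.exists_mem_ne_zero_of_ne_bot hker
  refine ⟨v, hv0, fun i => ?_⟩
  have := congrFun (LinearMap.mem_ker.1 hv) i
  simpa [Matrix.mulVec, dotProduct, mul_comm] using this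

end QuadraticFour

theorem corollary9 (κ : ℝ) (hκ : 1 < κ) :
    (∀ μ₁ μ₂ μ₃ μ₄ : ℝ,
      (∀ s ∈ Set.Ioo 1 κ, QuadraticFour.genS κ μ₁ μ₂ μ₃ μ₄ s = 0) ↔
        (μ₁ = 0 ∧ μ₂ = 0 ∧ μ₃ = 0 ∧ μ₄ = 0)) ∧
    (∀ δ : ℝ, 0 < δ → ∃ μ₁ μ₂ μ₃ μ₄ : ℝ,
      (∃ s ∈ Set.Ioo 1 κ, QuadraticFour.genS κ μ₁ μ₂ μ₃ μ₄ s ≠ 0) ∧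
      ∃ s₁ s₂ s₃ : ℝ, 1 < s₁ ∧ κ - δ < s₁ ∧ s₁ < s₂ ∧ s₂ < s₃ ∧ s₃ < κ ∧
        QuadraticFour.genS κ μ₁ μ₂ μ₃ μ₄ s₁ = 0 ∧
        QuadraticFour.genS κ μ₁ μ₂ μ₃ μ₄ s₂ = 0 ∧
        QuadraticFour.genS κ μ₁ μ₂ μ₃ μ₄ s₃ = 0) := by
  refine ⟨fun μ₁ μ₂ μ₃ μ₄ => ⟨QuadraticFour.params_eq_zero hκ, ?_⟩, fun δ hδ => ?_⟩
  · rintro ⟨rfl, rfl, rfl, rfl⟩ s -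
    simp [QuadraticFour.genS, QuadraticFour.genH]
  -- Any three points between `max 1 (κ - δ)` and `κ` will do.
  · obtain ⟨s₁, h1, h1κ⟩ := exists_between (max_lt hκ (by linarith : κ - δ < κ))
    obtain ⟨s₂, h2, h2κ⟩ := exists_between h1κ
    obtain ⟨s₃, h3, h3κ⟩ := exists_between h2κ
    obtain ⟨a₁, b₁, c₁, d₁, e₁⟩ := QuadraticFour.genS_linear κ s₁
    obtain ⟨a₂, b₂, c₂, d₂, e₂⟩ := QuadraticFour.genS_linear κ s₂
    obtain ⟨a₃, b₃, c₃, d₃, e₃⟩ := QuadraticFour.genS_linear κ s₃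
    obtain ⟨v, hv, hA⟩ := QuadraticFour.exists_nontrivial_solution
      ![![a₁, b₁, c₁, d₁], ![a₂, b₂, c₂, d₂], ![a₃, b₃, c₃, d₃]]
    have hA1 := hA 0
    have hA2 := hA 1
    have hA3 := hA 2
    simp [Fin.sum_univ_four] at hA1 hA2 hA3
    refine ⟨v 0, v 1, v 2, v 3, ?_, s₁, s₂, s₃, (le_max_left _ _).trans_lt h1,
      (le_max_right _ _).trans_lt h1, h2, h3, h3κ, by rw [e₁, hA1], by rw [e₂, hA2],
      by rw [e₃, hA3]⟩
    -- Vanishing on all of `(1,κ)` would force the nonzero vector `v` to be zero by part (i).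
    by_contra hall
    push Not at hall
    obtain ⟨z0, z1, z2, z3⟩ := QuadraticFour.params_eq_zero hκ hall
    exact hv (funext fun i => by fin_cases i <;> assumption)
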